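/- **Theorem 5.1 (linearization of elliptic operators).** Let $V,W$ be finite-dimensional real inner product spaces, let $n\in\mathbb N$, $k\ge 1$, and let $\mathcal A[D]=\sum_{|\alpha|=k}A_\alpha\partial^\alpha$, $A_\alpha\in\mathrm{Lin}(V;W)$, be a homogeneous $k$-th order operator with constant coefficients on $\mathbb R^n$, with symbol $\mathbb A^k(\xi)=\sum_{|\alpha|=k}\xi^\alpha A_\alpha$. An operator is *elliptic* if its symbol is injective for every $0\ne\xi\in\mathbb R^n$, and *$\mathbb C$-elliptic* if the complexified symbol is injective on the complexification of its domain for every $0\ne\xi\in\mathbb C^n$. Let $V\bigodot^{m}\mathbb R^n$ be the space of symmetric $m$-linear maps $F$ on $\mathbb R^n$ with values in $V$; for $|\gamma|=m$ write $F_\gamma\in V$ for the value of $F$ at the vectors $e_1,\dots,e_1,\dots,e_n,\dots,e_n$ ($e_i$ repeated $\gamma_i$ times), so that $(\nabla^m u)_\gamma=\partial^\gamma u$, and write $a\otimes^m\nu$ for the map $(x_1,\dots,x_m)\mapsto (\nu\cdot x_1)\cdots(\nu\cdot x_m)\,a$. Let $\mathcal L(\mathcal A)=\tilde{\mathcal A}\oplus\operatorname{curl}_{k-1}$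 be the first-order operator acting on maps $F$ with values in $V\bigodot^{k-1}\mathbb R^n$, where $$\tilde{\mathcal A}F=\sum_{i=1}^n\sum_{|\beta|=k-1}\frac1{c^i_\beta}A_{\beta+e_i}\,\partial_iF_\beta,\qquad c^i_\beta=\#\{(\gamma,l): |\gamma|=k-1,\ 1\le l\le n,\ \gamma+e_l=\beta+e_i\},$$ $$(\operatorname{curl}_{k-1}F)_{i,l,\beta}=\partial_iF_{\beta+e_l}-\partial_lF_{\beta+e_i},\qquad 1\le i,l\le n,\ |\beta|=k-2$$ (for $k=1$ there is no such $\beta$ and $\operatorname{curl}_0$ takes values in the zero space). It takes values in $W\oplus Z$, where $Z$ is the space of families $(z_{i,l,\beta})$ in $V$. For an operator $\mathcal B$ from $X$ to $Y$ and an open set $\Omega\subset\mathbb R^n$, $\mathrm{BV}^{\mathcal B}(\Omega)$ is the set of $u\in L^1(\Omega;X)$ whose distributional $\mathcal B u$ is a $Y$-valued bounded Radon measure on $\Omega$; $\mathrm{BV}^{\mathcal B}_{\mathrm{loc}}(\Omega)$ is the set of $u\in L^1_{\mathrm{loc}}(\Omega;X)$ for which $\mathcal B u$ is a $Y$-valued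 Radon measure on $\Omega$. Then: 1. $\mathcal L(\mathcal A)$ is elliptic if and only if $\mathcal A$ is elliptic. 2. $\mathcal L(\mathcal A)$ is $\mathbb C$-elliptic if and only if $\mathcal A$ is $\mathbb C$-elliptic. 3. If $\mathcal A$ is elliptic, $\Omega\subset\mathbb R^n$ is open and $u\in\mathrm{BV}^{\mathcal A}(\Omega)$, then the weak derivative $\nabla^{k-1}u$ exists in $L^1_{\mathrm{loc}}(\Omega;V\bigodot^{k-1}\mathbb R^n)$, it belongs to $\mathrm{BV}^{\mathcal L(\mathcal A)}_{\mathrm{loc}}(\Omega)$, and $$\mathcal L(\mathcal A)(\nabla^{k-1}u)=(\mathcal A u,0)\quad\text{as measures on }\Omega .$$ Moreover $\nabla^{k-1}u\in\mathrm{BV}^{\mathcal L(\mathcal A)}(\Omega)$ if $\Omega=\mathbb R^n$, and also whenever $\nabla^{k-1}u\in L^1(\Omega)$. 4. Let $f^+,f^-\in V\bigodot^{k-1}\mathbb R^n$ and $\nu\in\mathbb S^{n-1}$, and let $\mathbf 1_{(f^+,f^-,\nu)}(y)$ be $f^+$ if $y\cdot\nu\ge0$ and $f^-$ if $y\cdot\nu<0$.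 Then $\mathcal L(\mathcal A)(\mathbf 1_{(f^+,f^-,\nu)})=(\mu,0)$ on $\mathbb R^n$ for some $W$-valued Radon measure $\mu$ on $\mathbb R^n$ if and only if $f^+-f^-=a\otimes^{k-1}\nu$ for some $a\in V$. -/

import Mathlib

open MeasureTheory TopologicalSpace
open scoped Distributions TensorProduct RealInnerProductSpace

noncomputable section

namespace LinearizedOp

/-- `ℝⁿ` with its Euclidean norm. -/
abbrev Eu (n : ℕ) : Type := EuclideanSpace ℝ (Fin n)

/-! ### Multi-indices -/

/-- Multi-indices `α ∈ ℕⁿ` of modulus `|α| = k`. -/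
abbrev MultiIdx (n k : ℕ) : Type := {α : Fin n → ℕ // ∑ i, α i = k}

instance (n k : ℕ) : Fintype (MultiIdx n k) :=
  Fintype.subtype (Finset.piAntidiag Finset.univ k) (by simp)

/-- Multi-indices `β ∈ ℕⁿ` with `|β| = m - 1`; there are none when `m = 0`. -/
abbrev PredIdx (n m : ℕ) : Type := {β : Fin n → ℕ // ∑ i, β i + 1 = m}

instance (n m : ℕ) : Fintype (PredIdx n m) :=
  Fintype.subtype ((Finset.piAntidiag Finset.univ (m - 1)).filter (fun β => ∑ i, β i + 1 = m))
    (by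
      intro β
      have hiff : ∑ i, β i + 1 = m → ∑ i, β i = m - 1 := fun h => by omega
      simpa using hiff)

theorem sum_add_single {n : ℕ} (β : Fin n → ℕ) (i : Fin n) :
    ∑ j, (β + Pi.single i 1 : Fin n → ℕ) j = ∑ j, β j + 1 := by
  simp [Finset.sum_add_distrib]

/-- `β + eᵢ`, for `|β| = k`. -/
def MultiIdx.succ {n k : ℕ} (β : MultiIdx n k) (i : Fin n) : MultiIdx n (k + 1) :=
  ⟨β.1 + Pi.single i 1, by rw [sum_add_single, β.2]⟩

/-- `β + eᵢ`, for `|β| = m - 1`. -/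
def PredIdx.succ {n m : ℕ} (β : PredIdx n m) (i : Fin n) : MultiIdx n m :=
  ⟨β.1 + Pi.single i 1, by rw [sum_add_single, β.2]⟩

/-- The non-decreasing list of coordinates in which `i` occurs `α i` times. -/
def coordList {n : ℕ} (α : Fin n → ℕ) : List (Fin n) :=
  (List.finRange n).flatMap (fun i => List.replicate (α i) i)

theorem coordList_length {n : ℕ} (α : Fin n → ℕ) : (coordList α).length = ∑ i, α i := by
  simp [coordList, List.length_flatMap, ← List.ofFn_eq_map, List.sum_ofFn]

/-- The coordinate vectors `(e₁, …, e₁, e₂, …, e₂, …)`, with `eᵢ` repeated `α i` times. -/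
def MultiIdx.vecs {n k : ℕ} (α : MultiIdx n k) : Fin k → Eu n := fun p =>
  EuclideanSpace.single
    ((coordList α.1).get (p.cast ((coordList_length α.1).trans α.2).symm)) (1 : ℝ)

/-- The partial derivative `∂^α f`. -/
def partialD {n k : ℕ} {X : Type*} [NormedAddCommGroup X] [NormedSpace ℝ X]
    (α : MultiIdx n k) (f : Eu n → X) (x : Eu n) : X :=
  iteratedFDeriv ℝ k f x α.vecs

/-! ### Homogeneous operators with constant coefficients -/

/-- A `k`-th order homogeneous operator `∑_{|α| = k} A_α ∂^α` from `X` to `Y`, given by its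
constant coefficients `A_α ∈ Lin(X; Y)`. -/
abbrev HomOp (n k : ℕ) (X Y : Type*) [AddCommGroup X] [Module ℝ X]
    [AddCommGroup Y] [Module ℝ Y] : Type _ :=
  MultiIdx n k → (X →ₗ[ℝ] Y)

/-- The first-order operator `∑ⱼ Cⱼ ∂ⱼ`: the coefficient at the multi-index `eⱼ` is `Cⱼ`. -/
def firstOrder {n : ℕ} {X Y : Type*} [AddCommGroup X] [Module ℝ X]
    [AddCommGroup Y] [Module ℝ Y] (C : Fin n → (X →ₗ[ℝ] Y)) : HomOp n 1 X Y :=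
  fun α => ∑ j, α.1 j • C j

section Symbols

variable {n k : ℕ} {X Y : Type*} [AddCommGroup X] [Module ℝ X] [AddCommGroup Y] [Module ℝ Y]

/-- The principal symbol `∑_{|α| = k} ξ^α A_α`, `ξ ∈ ℝⁿ`. -/
def HomOp.symbol (A : HomOp n k X Y) (ξ : Eu n) : X →ₗ[ℝ] Y :=
  ∑ α : MultiIdx n k, (∏ i, ξ i ^ α.1 i) • A α

/-- The complexified principal symbol `∑_{|α| = k} ξ^α A_α : ℂ ⊗ X → ℂ ⊗ Y`, `ξ ∈ ℂⁿ`. -/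
def HomOp.symbolC (A : HomOp n k X Y) (ξ : Fin n → ℂ) : (ℂ ⊗[ℝ] X) →ₗ[ℂ] (ℂ ⊗[ℝ] Y) :=
  ∑ α : MultiIdx n k, (∏ i, ξ i ^ α.1 i) • (A α).baseChange ℂ

/-- Ellipticity: the symbol is injective at every nonzero real frequency. -/
def HomOp.IsElliptic (A : HomOp n k X Y) : Prop :=
  ∀ ξ : Eu n, ξ ≠ 0 → Function.Injective (A.symbol ξ)

/-- `ℂ`-ellipticity: the complexified symbol is injective at every nonzero complex frequency. -/
def HomOp.IsCElliptic (A : HomOp n k X Y) : Prop :=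
  ∀ ξ : Fin n → ℂ, ξ ≠ 0 → Function.Injective (A.symbolC ξ)

end Symbols

/-! ### Vector-valued Radon measures and functions of bounded `𝒜`-variation -/

/-- An `X`-valued Radon measure on the open set `Ω`, written as `σ m` with `m` a positive Radon
measure and `σ` an `X`-valued density that is locally `m`-integrable on `Ω`. For
finite-dimensional `X` every `X`-valued Radon measure is of this form. -/
structure RadonMeasure {n : ℕ} (Ω : Opens (Eu n)) (X : Type*) [NormedAddCommGroup X] where
  /-- the positive measure `m` -/
  base : Measure (Eu n)
  /-- the density `σ` -/
  density : Eu n → X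
  locallyFinite : IsLocallyFiniteMeasure base
  locallyIntegrable : LocallyIntegrableOn density (Ω : Set (Eu n)) base

section Measures

variable {n : ℕ} {Ω : Opens (Eu n)} {X Z : Type*} [NormedAddCommGroup X] [NormedAddCommGroup Z]

/-- The total variation `∫_Ω |σ| dm` is finite. -/
def RadonMeasure.IsBounded (μ : RadonMeasure Ω X) : Prop :=
  IntegrableOn μ.density (Ω : Set (Eu n)) μ.base

/-- `∫_Ω φ dμ` for a scalar function `φ`. -/
def RadonMeasure.integral [NormedSpace ℝ X] (μ : RadonMeasure Ω X) (φ : Eu n → ℝ) : X :=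
  ∫ x in (Ω : Set (Eu n)), φ x • μ.density x ∂μ.base

/-- The measure `(μ, 0)` with values in `X × Z`. -/
def RadonMeasure.pairZero (Z : Type*) [NormedAddCommGroup Z] (μ : RadonMeasure Ω X) :
    RadonMeasure Ω (X × Z) where
  base := μ.base
  density := fun x => (μ.density x, 0)
  locallyFinite := μ.locallyFinite
  locallyIntegrable := fun x hx => by
    obtain ⟨t, ht, hi⟩ := μ.locallyIntegrable x hx
    exact ⟨t, ht, hi.prodMk (integrable_zero _ _ _)⟩

end Measures

section BV

variable {n k : ℕ} {X Y : Type*} [NormedAddCommGroup X] [NormedSpace ℝ X]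
  [NormedAddCommGroup Y] [NormedSpace ℝ Y]

/-- `𝒜u = μ` in the sense of distributions on `Ω`: for every scalar test function,
`∫_Ω φ dμ = (-1)^k ∑_{|α| = k} ∫_Ω ∂^αφ A_α u dx`. By taking components this is the same as
testing with `Y`-valued `φ` against the adjoint operator
`𝒜* = (-1)^k ∑_{|α| = k} A_α* ∂^α`. -/
def HomOp.Represents (A : HomOp n k X Y) (Ω : Opens (Eu n)) (u : Eu n → X)
    (μ : RadonMeasure Ω Y) : Prop :=
  ∀ φ : 𝓓(Ω, ℝ), μ.integral φ =
    (-1 : ℝ) ^ k • ∑ α : MultiIdx n k, ∫ x in (Ω : Set (Eu n)), partialD α φ x • A α (u x)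

/-- `u ∈ BV^𝒜(Ω)`. -/
def HomOp.MemBV (A : HomOp n k X Y) (Ω : Opens (Eu n)) (u : Eu n → X) : Prop :=
  IntegrableOn u (Ω : Set (Eu n)) ∧
    ∃ μ : RadonMeasure Ω Y, μ.IsBounded ∧ A.Represents Ω u μ

/-- `u ∈ BV^𝒜_loc(Ω)`. -/
def HomOp.MemBVLoc (A : HomOp n k X Y) (Ω : Opens (Eu n)) (u : Eu n → X) : Prop :=
  LocallyIntegrableOn u (Ω : Set (Eu n)) ∧ ∃ μ : RadonMeasure Ω Y, A.Represents Ω u μ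

end BV

/-! ### Symmetric multilinear maps -/

section Sym

variable {n m : ℕ} {V : Type*} [NormedAddCommGroup V] [NormedSpace ℝ V]

/-- `V ⊙^m ℝⁿ`: the space of symmetric `m`-linear maps on `ℝⁿ` with values in `V`. -/
def symSubmodule (n m : ℕ) (V : Type*) [NormedAddCommGroup V] [NormedSpace ℝ V] :
    Submodule ℝ (ContinuousMultilinearMap ℝ (fun _ : Fin m => Eu n) V) where
  carrier := {F | ∀ (s : Equiv.Perm (Fin m)) (x : Fin m → Eu n), F (x ∘ s) = F x}
  add_mem' := fun hF hG s x => by simp [hF s x, hG s x]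
  zero_mem' := fun s x => by simp
  smul_mem' := fun c F hF s x => by simp [hF s x]

/-- `V ⊙^m ℝⁿ` as a normed space. -/
abbrev SymTensor (n m : ℕ) (V : Type*) [NormedAddCommGroup V] [NormedSpace ℝ V] : Type _ :=
  ↥(symSubmodule n m V)

/-- The coordinate `F_γ = F(e₁, …, e₁, e₂, …, e₂, …)`, `eᵢ` occurring `γᵢ` times. -/
def SymTensor.coeff (γ : MultiIdx n m) : SymTensor n m V →ₗ[ℝ] V where
  toFun F := F.1 γ.vecs
  map_add' := fun _ _ => rfl
  map_smul' := fun _ _ => rfl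

/-- `a ⊗^m ν`, i.e. the map `(x₁, …, x_m) ↦ (ν · x₁) ⋯ (ν · x_m) a`. -/
def SymTensor.pure (m : ℕ) (a : V) (ν : Eu n) : SymTensor n m V :=
  ⟨((ContinuousMultilinearMap.mkPiAlgebra ℝ (Fin m) ℝ).compContinuousLinearMap
      (fun _ => innerSL ℝ ν)).smulRight a, fun s x => by
    simp only [ContinuousMultilinearMap.smulRight_apply,
      ContinuousMultilinearMap.compContinuousLinearMap_apply,
      ContinuousMultilinearMap.mkPiAlgebra_apply, Function.comp_apply]
    rw [Equiv.prod_comp s (fun p => innerSL ℝ ν (x p))]⟩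

theorem SymTensor.pure_apply (m : ℕ) (a : V) (ν : Eu n) (x : Fin m → Eu n) :
    (SymTensor.pure m a ν).1 x = (∏ p, ⟪ν, x p⟫) • a := by
  simp [SymTensor.pure]

/-- `G` is the weak derivative `∇^m u` on `Ω`: a locally integrable map with values in
`V ⊙^m ℝⁿ` whose coordinate at each `|γ| = m` is the distributional derivative `∂^γ u`. -/
def IsWeakGrad (Ω : Opens (Eu n)) (u : Eu n → V) (G : Eu n → SymTensor n m V) : Prop :=
  LocallyIntegrableOn G (Ω : Set (Eu n)) ∧
    ∀ (γ : MultiIdx n m) (φ : 𝓓(Ω, ℝ)),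
      ∫ x in (Ω : Set (Eu n)), φ x • SymTensor.coeff γ (G x) =
        (-1 : ℝ) ^ m • ∫ x in (Ω : Set (Eu n)), partialD γ φ x • u x

/-- The piecewise constant map equal to `fp` on `{y · ν ≥ 0}` and to `fm` on `{y · ν < 0}`. -/
def jumpMap {X : Type*} (fp fm : X) (ν : Eu n) (y : Eu n) : X :=
  open Classical in if 0 ≤ ⟪y, ν⟫ then fp else fm

end Sym

/-! ### The linearized operator -/

section Linearize

variable {n m : ℕ} {V W : Type*} [NormedAddCommGroup V] [NormedSpace ℝ V]
  [NormedAddCommGroup W] [NormedSpace ℝ W]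

/-- The values of `curl_m`: one vector of `V` for each pair `(i, l)` and each multi-index `β`
with `|β| = m - 1`. This is the zero space when `m = 0`. -/
abbrev CurlTarget (n m : ℕ) (V : Type*) : Type _ := Fin n × Fin n × PredIdx n m → V

/-- The first-order operator `(curl_m F)_{i,l,β} = ∂ᵢ F_{β + e_l} - ∂_l F_{β + eᵢ}`. -/
def curlOp (n m : ℕ) (V : Type*) [NormedAddCommGroup V] [NormedSpace ℝ V] :
    HomOp n 1 (SymTensor n m V) (CurlTarget n m V) :=
  firstOrder fun j => LinearMap.pi fun q : Fin n × Fin n × PredIdx n m =>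
    (if q.1 = j then SymTensor.coeff (q.2.2.succ q.2.1) else 0) -
      (if q.2.1 = j then SymTensor.coeff (q.2.2.succ q.1) else 0)

/-- The number of pairs `(γ, l)` with `|γ| = |β|` and `γ + e_l = β + eᵢ`. -/
def multiplicity (β : MultiIdx n m) (i : Fin n) : ℕ :=
  (Finset.univ.filter fun p : MultiIdx n m × Fin n => p.1.succ p.2 = β.succ i).card

/-- The first-order operator `Ã F = ∑ᵢ ∑_{|β| = m} (c^i_β)⁻¹ A_{β + eᵢ} ∂ᵢ F_β` associated with
an operator `A` of order `m + 1`; the weights `c^i_β` make `Ã (∇^m u) = A u`. -/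
def tildeOp (A : HomOp n (m + 1) V W) : HomOp n 1 (SymTensor n m V) W :=
  firstOrder fun i => ∑ β : MultiIdx n m,
    (multiplicity β i : ℝ)⁻¹ • (A (β.succ i)).comp (SymTensor.coeff β)

/-- The linearized operator `L(A) = Ã ⊕ curl_m` of an operator `A` of order `m + 1`. -/
def linearize (A : HomOp n (m + 1) V W) :
    HomOp n 1 (SymTensor n m V) (W × CurlTarget n m V) :=
  fun α => (tildeOp A α).prod (curlOp n m V α)

end Linearize

end LinearizedOp

end

/-! Write `m = k - 1`. Everything algebraic rests on the kernel of the symbol of `curl` at `ξ ≠ 0`: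
the families `F_γ = ξ^γ a`, i.e. the tensors `a ⊗^m ξ` (`exists_monomial_smul_of_curl_eq_zero`). The
weights `1 / c^i_β` count each `α = β + e_i` exactly once (`sum_multiplicity_inv`), so on this
kernel the symbol of `Ã` acts as `a ↦ 𝔸(ξ) a`. Hence the symbol of `L(A)` is injective at `ξ`
exactly when that of `A` is. The argument works over any field of characteristic zero, so it serves
the real and the complexified symbol alike.

For jumps, the distributional gradient of the indicator of a half-space is `ν` times a positive
measure `M` on the hyperplane (`exists_hyperplane_measure`). So `L(A)` of the jump map is `M` times
the symbol of `L(A)` at `ν` applied to `f⁺ - f⁻`, and its curl part vanishes exactly when `f⁺ - f⁻`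
lies in the kernel above.

If `∇^m u` exists, the identity `L(A)(∇^m u) = (A u, 0)` is formal
(`IsWeakGrad.represents_linearize`). The analytic core is the integrability of `∂^γ u`, `|γ| = m`.
Ellipticity gives a smooth left inverse of the symbol away from the origin. Cut off to a dyadic
annulus, it yields Schwartz functions `q_t` with `∑ ∂^α q_t b_t A_α = ∂^γ (2^n X(2·) - X)` and `∫ X
= 1` (`exists_dyadic_parametrix`). Rescaling by `2^N`, the right-hand sides telescope to an
approximate identity. Since `A` has one order more than `∂^γ`, the kernels on the left have `L¹`
norm `O(2^{-N})`.

To stay inside `Ω` the kernels are multiplied by a cutoff `θ` of radius `ε`. The resulting error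
lives where `ε / 2 ≤ |x| ≤ ε`, where Schwartz decay makes it `O(2^{-N})` too. Thus `∂^γ u` is a
smooth mollification plus a series, convergent in `L¹`, of convolutions with `A u` and `u`
(`exists_integrable_localDerivative`). An exhaustion of `Ω` glues these local derivatives. On `ℝⁿ`
one radius suffices, and integrability is global. -/

noncomputable section

namespace LinearizedOp

/-! ### Multi-indices and coordinates of symmetric tensors -/

section Combinatorics

variable {n m : ℕ}

/-- The multi-index counting how often each value is taken by `j`. -/
def countIdx (j : Fin m → Fin n) : MultiIdx n m :=
  ⟨fun i => (Finset.univ.filter fun p => j p = i).card, by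
    rw [← Finset.card_eq_sum_card_fiberwise (fun p _ => Finset.mem_univ (j p))]
    simp⟩

/-- The non-decreasing map `Fin m → Fin n` taking the value `i` exactly `γ i` times. -/
def MultiIdx.coords (γ : MultiIdx n m) (p : Fin m) : Fin n :=
  (coordList γ.1).get (p.cast ((coordList_length γ.1).trans γ.2).symm)

theorem MultiIdx.vecs_eq (γ : MultiIdx n m) :
    γ.vecs = fun p => EuclideanSpace.single (γ.coords p) (1 : ℝ) := rfl

theorem count_coordList (α : Fin n → ℕ) (i : Fin n) : (coordList α).count i = α i := by
  simp only [coordList, List.count_flatMap, Function.comp_def, List.count_replicate]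
  rw [← List.ofFn_eq_map, List.sum_ofFn]
  simp

theorem countIdx_coords (γ : MultiIdx n m) : countIdx γ.coords = γ := by
  apply Subtype.ext
  funext i
  change (Finset.univ.filter fun p => γ.coords p = i).card = γ.1 i
  rw [← count_coordList γ.1 i, Finset.card_filter]
  have hlen : m = (coordList γ.1).length := ((coordList_length γ.1).trans γ.2).symm
  have h1 : ∑ p : Fin m, (if γ.coords p = i then 1 else 0) =
      ∑ p : Fin (coordList γ.1).length, (if (coordList γ.1).get p = i then 1 else 0) :=
    Fintype.sum_equiv (finCongr hlen) _ _ (fun p => rfl)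
  rw [h1]
  have h2 := Fin.sum_univ_fun_getElem (coordList γ.1) (fun a => if a = i then 1 else 0)
  simp only [List.get_eq_getElem]
  rw [h2]
  induction coordList γ.1 with
  | nil => simp
  | cons a l ih => simp [List.count_cons, ih, add_comm]

/-- The fibres of the two words over each letter have equal size, and bijections between
corresponding fibres glue to a permutation. -/
theorem exists_perm_of_countIdx_eq {j j' : Fin m → Fin n} (h : countIdx j = countIdx j') :
    ∃ s : Equiv.Perm (Fin m), j' ∘ s = j := by
  have e : ∀ i, Nonempty ({p // j p = i} ≃ {p // j' p = i}) := fun i => by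
    have hi : (countIdx j).1 i = (countIdx j').1 i := by rw [h]
    apply Fintype.card_eq.mp
    simpa [countIdx, Fintype.card_subtype] using hi
  exact ⟨Equiv.ofFiberEquiv fun i => (e i).some,
    funext fun p => Equiv.ofFiberEquiv_map (fun i => (e i).some) p⟩

theorem countIdx_comp_perm (j : Fin m → Fin n) (s : Equiv.Perm (Fin m)) :
    countIdx (j ∘ s) = countIdx j := by
  apply Subtype.ext
  funext i
  change (Finset.univ.filter fun p => (j ∘ s) p = i).card =
    (Finset.univ.filter fun p => j p = i).card
  exact Finset.card_equiv s (by simp)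

theorem MultiIdx.exists_eq_succ (α : MultiIdx n (m + 1)) :
    ∃ (β : MultiIdx n m) (i : Fin n), β.succ i = α := by
  have h : ∃ i, 0 < α.1 i := by
    by_contra! h
    have := α.2
    rw [Finset.sum_eq_zero fun i _ => Nat.le_zero.mp (h i)] at this
    omega
  obtain ⟨i, hi⟩ := h
  have hsum : (α.1 - Pi.single i 1) + Pi.single i 1 = α.1 := by
    funext l
    rcases eq_or_ne l i with rfl | hl
    · simp only [Pi.add_apply, Pi.sub_apply, Pi.single_eq_same]; omega
    · simp [hl]
  refine ⟨⟨α.1 - Pi.single i 1, ?_⟩, i, Subtype.ext hsum⟩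
  have h1 := sum_add_single (α.1 - Pi.single i 1) i
  rw [hsum, α.2] at h1
  omega

theorem multiplicity_ne_zero (β : MultiIdx n m) (i : Fin n) : multiplicity β i ≠ 0 :=
  Finset.card_ne_zero_of_mem (a := (β, i)) (by simp)

/-- Group the pairs `(β, i)` by `α = β + e_i`. The fibre over `α` has exactly `multiplicity β i`
elements, and each of them carries the inverse of that number as weight. The field is general so
that both real and complex symbols are covered. -/
theorem sum_multiplicity_inv {K E : Type*} [Field K] [CharZero K] [AddCommGroup E] [Module K E]
    (f : MultiIdx n (m + 1) → E) :
    ∑ i : Fin n, ∑ β : MultiIdx n m, (multiplicity β i : K)⁻¹ • f (β.succ i) = ∑ α, f α := by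
  rw [Finset.sum_comm, ← Fintype.sum_prod_type'
    (f := fun (β : MultiIdx n m) i => (multiplicity β i : K)⁻¹ • f (β.succ i)),
    ← Finset.sum_fiberwise Finset.univ (fun p : MultiIdx n m × Fin n => p.1.succ p.2)]
  refine Finset.sum_congr rfl fun α _ => ?_
  obtain ⟨β, i, rfl⟩ := α.exists_eq_succ
  rw [Finset.sum_congr rfl (g := fun _ => (multiplicity β i : K)⁻¹ • f (β.succ i))]
  · rw [Finset.sum_const]
    change multiplicity β i • _ = _
    rw [← Nat.cast_smul_eq_nsmul K, smul_smul,
      mul_inv_cancel₀ (Nat.cast_ne_zero.mpr (multiplicity_ne_zero β i)), one_smul]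
  · intro p hp
    have hp' : p.1.succ p.2 = β.succ i := by simpa using hp
    simp only [multiplicity, hp']

/-- The monomial `ξ^α`. -/
def monomial {K : Type*} [CommSemiring K] (ξ : Fin n → K) (α : Fin n → ℕ) : K :=
  ∏ i, ξ i ^ α i

theorem monomial_add_single {K : Type*} [CommSemiring K] (ξ : Fin n → K) (α : Fin n → ℕ)
    (i : Fin n) : monomial ξ (α + Pi.single i 1) = monomial ξ α * ξ i := by
  simp only [monomial, Pi.add_apply, pow_add, Finset.prod_mul_distrib]
  congr 1
  rw [Finset.prod_eq_single i] <;> simp +contextual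

theorem MultiIdx.exists_eq_predIdx_succ (γ : MultiIdx n m) {l : Fin n} (hl : γ.1 l ≠ 0) :
    ∃ β : PredIdx n m, β.succ l = γ := by
  have hsum : (γ.1 - Pi.single l 1) + Pi.single l 1 = γ.1 := by
    funext i
    rcases eq_or_ne i l with rfl | hi
    · simp only [Pi.add_apply, Pi.sub_apply, Pi.single_eq_same]; omega
    · simp [hi]
  refine ⟨⟨γ.1 - Pi.single l 1, ?_⟩, Subtype.ext hsum⟩
  have h1 := sum_add_single (γ.1 - Pi.single l 1) l
  rw [hsum, γ.2] at h1
  omega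

/-- The families annihilated by the symbol of `curl` at `ξ ≠ 0` are the multiples of
`γ ↦ ξ^γ`. -/
theorem exists_monomial_smul_of_curl_eq_zero {K E : Type*} [Field K] [AddCommGroup E] [Module K E]
    {ξ : Fin n → K} (hξ : ξ ≠ 0) {F : MultiIdx n m → E}
    (h : ∀ (i l : Fin n) (β : PredIdx n m), ξ i • F (β.succ l) = ξ l • F (β.succ i)) :
    ∃ a : E, ∀ γ : MultiIdx n m, F γ = monomial ξ γ.1 • a := by
  obtain ⟨i, hi⟩ := Function.ne_iff.mp hξ
  simp only [Pi.zero_apply] at hi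
  -- With `ξ i ≠ 0`, the coordinate at `m e_i` must be `ξ_i^m a`, which determines `a`.
  let γ₀ : MultiIdx n m := ⟨Pi.single i m, by simp⟩
  refine ⟨(ξ i ^ m)⁻¹ • F γ₀, fun γ => ?_⟩
  -- Induction on the number of entries of `γ` away from `i`: the curl relation trades one `e_l` for
  -- an `e_i`, at the cost of the factor `ξ_l / ξ_i`.
  induction hd : m - γ.1 i using Nat.strong_induction_on generalizing γ with
  | _ d ih =>
    by_cases hγ : ∃ l, l ≠ i ∧ γ.1 l ≠ 0
    · obtain ⟨l, hli, hl⟩ := hγ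
      obtain ⟨β, rfl⟩ := γ.exists_eq_predIdx_succ hl
      have hβi : (β.succ i).1 i = (β.succ l).1 i + 1 := by
        simp [PredIdx.succ, hli.symm]
      have hle : (β.succ i).1 i ≤ m := by
        conv_rhs => rw [← (β.succ i).2]
        exact Finset.single_le_sum (fun _ _ => Nat.zero_le _) (Finset.mem_univ i)
      have key := ih (m - (β.succ i).1 i) (by omega) (β.succ i) rfl
      have e1 : F (β.succ l) = (ξ i)⁻¹ • ξ l • F (β.succ i) := by
        rw [← h i l β, smul_smul, inv_mul_cancel₀ hi, one_smul]
      rw [e1, key]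
      simp only [PredIdx.succ, monomial_add_single, smul_smul]
      congr 1
      field_simp
    · push Not at hγ
      have hγ₀ : γ.1 = γ₀.1 := by
        have hm : γ.1 i = m :=
          (Finset.sum_eq_single i (fun l _ hl => hγ l hl) (by simp)).symm.trans γ.2
        funext l
        rcases eq_or_ne l i with rfl | hl
        · simp [γ₀, hm]
        · simp [γ₀, hl, hγ l hl]
      rw [Subtype.ext hγ₀]
      have : monomial ξ γ₀.1 = ξ i ^ m := by
        simp only [monomial, γ₀]
        rw [Finset.prod_eq_single i] <;> simp +contextual
      rw [this, smul_smul, mul_inv_cancel₀ (pow_ne_zero _ hi), one_smul]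

end Combinatorics

/-! ### Symmetric tensors determined by their coordinates -/

section Coefficients

variable {n m : ℕ} {V : Type*} [NormedAddCommGroup V] [NormedSpace ℝ V]

theorem SymTensor.apply_single (F : SymTensor n m V) (j : Fin m → Fin n) :
    F.1 (fun p => EuclideanSpace.single (j p) (1 : ℝ)) = SymTensor.coeff (countIdx j) F := by
  obtain ⟨s, hs⟩ := exists_perm_of_countIdx_eq (countIdx_coords (countIdx j))
  rw [← F.2 s]
  change F.1 (fun p => EuclideanSpace.single ((j ∘ s) p) (1 : ℝ)) = _
  rw [hs]
  rfl

/-- The symmetric tensor with prescribed coordinates. -/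
def SymTensor.ofCoeff (c : MultiIdx n m → V) : SymTensor n m V :=
  ⟨∑ j : Fin m → Fin n,
    ((ContinuousMultilinearMap.mkPiAlgebra ℝ (Fin m) ℝ).compContinuousLinearMap
      (fun p => EuclideanSpace.proj (j p))).smulRight (c (countIdx j)), fun s x => by
    simp only [_root_.sum_apply, ContinuousMultilinearMap.smulRight_apply,
      ContinuousMultilinearMap.compContinuousLinearMap_apply,
      ContinuousMultilinearMap.mkPiAlgebra_apply, Function.comp_apply]
    -- Permuting the arguments permutes the words `j`, and `countIdx` does not see the order of the
    -- letters.
    refine Fintype.sum_equiv (s.arrowCongr (Equiv.refl (Fin n))) _ _ fun j => ?_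
    have h1 : s.arrowCongr (Equiv.refl (Fin n)) j = j ∘ s.symm := rfl
    rw [h1, countIdx_comp_perm]
    congr 1
    refine Fintype.prod_equiv s _ _ fun p => ?_
    simp⟩

theorem SymTensor.coeff_ofCoeff (c : MultiIdx n m → V) (γ : MultiIdx n m) :
    SymTensor.coeff γ (SymTensor.ofCoeff c) = c γ := by
  change (SymTensor.ofCoeff c).1 γ.vecs = _
  simp only [SymTensor.ofCoeff, _root_.sum_apply,
    ContinuousMultilinearMap.smulRight_apply,
    ContinuousMultilinearMap.compContinuousLinearMap_apply,
    ContinuousMultilinearMap.mkPiAlgebra_apply, MultiIdx.vecs_eq]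
  -- At the vectors `γ.vecs` only the word `γ.coords` contributes. This is why the sum over words in
  -- `SymTensor.ofCoeff` carries no multinomial weights.
  rw [Finset.sum_eq_single γ.coords]
  · simp [countIdx_coords]
  · intro j _ hj
    obtain ⟨p, hp⟩ := Function.ne_iff.mp hj
    rw [Finset.prod_eq_zero (Finset.mem_univ p), zero_smul]
    simp [hp]
  · simp

theorem SymTensor.ext_coeff {F G : SymTensor n m V}
    (h : ∀ γ, SymTensor.coeff γ F = SymTensor.coeff γ G) : F = G := by
  apply Subtype.ext
  apply ContinuousMultilinearMap.toMultilinearMap_injective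
  refine Module.Basis.ext_multilinear (fun _ => (EuclideanSpace.basisFun (Fin n) ℝ).toBasis)
    fun j => ?_
  simpa [SymTensor.apply_single] using h (countIdx j)

variable (n m V) in
/-- A symmetric tensor amounts to the family of its coordinates. -/
def coeffEquiv : SymTensor n m V ≃ₗ[ℝ] (MultiIdx n m → V) :=
  LinearEquiv.ofBijective (LinearMap.pi SymTensor.coeff)
    ⟨fun _ _ h => SymTensor.ext_coeff fun γ => congrFun h γ,
      fun c => ⟨SymTensor.ofCoeff c, funext fun γ => SymTensor.coeff_ofCoeff c γ⟩⟩

@[simp]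
theorem coeffEquiv_apply (F : SymTensor n m V) (γ : MultiIdx n m) :
    coeffEquiv n m V F γ = SymTensor.coeff γ F := rfl

instance [FiniteDimensional ℝ V] : FiniteDimensional ℝ (SymTensor n m V) :=
  (coeffEquiv n m V).symm.finiteDimensional

theorem prod_coords {K : Type*} [CommSemiring K] (ξ : Fin n → K) (γ : MultiIdx n m) :
    ∏ p, ξ (γ.coords p) = monomial ξ γ.1 := by
  conv_rhs => rw [← countIdx_coords γ]
  simp only [monomial, countIdx]
  rw [← Finset.prod_fiberwise' Finset.univ γ.coords ξ]
  simp

theorem SymTensor.coeff_pure (a : V) (ν : Eu n) (γ : MultiIdx n m) :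
    SymTensor.coeff γ (SymTensor.pure m a ν) = monomial ν γ.1 • a := by
  change (SymTensor.pure m a ν).1 γ.vecs = _
  rw [SymTensor.pure_apply, MultiIdx.vecs_eq, ← prod_coords]
  simp [EuclideanSpace.inner_single_right]

end Coefficients

/-! ### Ellipticity of the linearized operator -/

section FirstOrder

variable {n : ℕ}

/-- The multi-index `eⱼ`. -/
def MultiIdx.unit (j : Fin n) : MultiIdx n 1 := ⟨Pi.single j 1, by simp⟩

theorem MultiIdx.unit_bijective : Function.Bijective (MultiIdx.unit (n := n)) := by
  constructor
  · intro j l h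
    have h1 := congrFun (congrArg Subtype.val h) j
    by_contra hne
    simp [MultiIdx.unit, hne] at h1
  · intro α
    obtain ⟨β, i, rfl⟩ := α.exists_eq_succ
    have hβ : β.1 = 0 := funext fun l => by simpa using (Finset.sum_eq_zero_iff.mp β.2) l
    exact ⟨i, Subtype.ext (by simp [MultiIdx.unit, MultiIdx.succ, hβ])⟩

theorem sum_multiIdx_one {E : Type*} [AddCommMonoid E] (f : MultiIdx n 1 → E) :
    ∑ α, f α = ∑ j, f (MultiIdx.unit j) :=
  (Fintype.sum_bijective _ MultiIdx.unit_bijective _ _ fun _ => rfl).symm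

theorem firstOrder_unit {X Y : Type*} [AddCommGroup X] [Module ℝ X] [AddCommGroup Y] [Module ℝ Y]
    (C : Fin n → (X →ₗ[ℝ] Y)) (j : Fin n) : firstOrder C (MultiIdx.unit j) = C j := by
  rw [firstOrder, Finset.sum_eq_single j] <;> simp +contextual [MultiIdx.unit]

theorem monomial_unit {K : Type*} [CommSemiring K] (ξ : Fin n → K) (j : Fin n) :
    monomial ξ (MultiIdx.unit j).1 = ξ j := by
  have h := monomial_add_single ξ 0 j
  rw [zero_add] at h
  simpa [MultiIdx.unit, monomial] using h

end FirstOrder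

/-! ### Symbols over a general field -/

section Symbol

variable {n m : ℕ} {K E E' : Type*} [Field K] [AddCommGroup E] [Module K E]
  [AddCommGroup E'] [Module K E']

/-- The curl relations force `F_γ = ξ^γ a`. Then `ht` says that the symbol of order `m + 1` kills
`a`. -/
theorem eq_zero_of_injective_symbol [CharZero K] {c : MultiIdx n (m + 1) → (E →ₗ[K] E')}
    {ξ : Fin n → K} (hξ : ξ ≠ 0)
    (hinj : Function.Injective (∑ α : MultiIdx n (m + 1), monomial ξ α.1 • c α : E →ₗ[K] E'))
    {F : MultiIdx n m → E}
    (ht : ∑ j, ∑ β : MultiIdx n m, (multiplicity β j : K)⁻¹ • ξ j • c (β.succ j) (F β) = 0)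
    (hc : ∀ (i l : Fin n) (β : PredIdx n m), ξ i • F (β.succ l) = ξ l • F (β.succ i)) :
    F = 0 := by
  obtain ⟨a, ha⟩ := exists_monomial_smul_of_curl_eq_zero hξ hc
  have h0 : a = 0 := by
    apply hinj
    rw [map_zero, LinearMap.sum_apply, ← sum_multiplicity_inv (K := K), ← ht]
    refine Finset.sum_congr rfl fun j _ => Finset.sum_congr rfl fun β _ => ?_
    rw [ha β, map_smul, smul_smul (ξ j), LinearMap.smul_apply]
    simp only [MultiIdx.succ, monomial_add_single, mul_comm]
  funext γ
  simp [ha γ, h0]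

/-- If the symbol kills `a`, the family `ξ^γ a` satisfies both conditions in `h`, hence vanishes;
its coordinate at `m e_i` with `ξ_i ≠ 0` gives `a = 0`. -/
theorem injective_symbol_of_forall [CharZero K] {c : MultiIdx n (m + 1) → (E →ₗ[K] E')}
    {ξ : Fin n → K} (hξ : ξ ≠ 0)
    (h : ∀ F : MultiIdx n m → E,
      ∑ j, ∑ β : MultiIdx n m, (multiplicity β j : K)⁻¹ • ξ j • c (β.succ j) (F β) = 0 →
      (∀ (i l : Fin n) (β : PredIdx n m), ξ i • F (β.succ l) = ξ l • F (β.succ i)) → F = 0) :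
    Function.Injective (∑ α : MultiIdx n (m + 1), monomial ξ α.1 • c α : E →ₗ[K] E') := by
  rw [injective_iff_map_eq_zero]
  intro a ha
  have hF := h (fun γ => monomial ξ γ.1 • a) ?_ ?_
  · obtain ⟨i, hi⟩ := Function.ne_iff.mp hξ
    simp only [Pi.zero_apply] at hi
    have h1 := congrFun hF ⟨Pi.single i m, by simp⟩
    have h2 : monomial ξ (Pi.single i m) = ξ i ^ m := by
      rw [monomial, Finset.prod_eq_single i] <;> simp +contextual
    simpa [h2, hi] using h1
  · rw [← ha, LinearMap.sum_apply, ← sum_multiplicity_inv (K := K)]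
    refine Finset.sum_congr rfl fun j _ => Finset.sum_congr rfl fun β _ => ?_
    rw [map_smul, smul_smul (ξ j), LinearMap.smul_apply]
    simp only [MultiIdx.succ, monomial_add_single, mul_comm]
  · intro i l β
    simp only [PredIdx.succ, monomial_add_single, smul_smul]
    congr 1
    ring

end Symbol

/-! ### Real and complexified symbols of the linearized operator -/

section Elliptic

variable {n m : ℕ} {V W : Type*} [NormedAddCommGroup V] [NormedSpace ℝ V]
  [NormedAddCommGroup W] [NormedSpace ℝ W]

theorem linearize_unit (A : HomOp n (m + 1) V W) (j : Fin n) :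
    linearize A (MultiIdx.unit j) =
      (∑ β : MultiIdx n m,
        (multiplicity β j : ℝ)⁻¹ • (A (β.succ j)).comp (SymTensor.coeff β)).prod
      (LinearMap.pi fun q : Fin n × Fin n × PredIdx n m =>
        (if q.1 = j then SymTensor.coeff (q.2.2.succ q.2.1) else 0) -
          (if q.2.1 = j then SymTensor.coeff (q.2.2.succ q.1) else 0)) := by
  simp only [linearize, tildeOp, curlOp, firstOrder_unit]

theorem fst_linearize_unit (A : HomOp n (m + 1) V W) (j : Fin n) (F : SymTensor n m V) :
    (linearize A (MultiIdx.unit j) F).1 =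
      ∑ β : MultiIdx n m, (multiplicity β j : ℝ)⁻¹ • A (β.succ j) (SymTensor.coeff β F) := by
  rw [linearize_unit]
  change (∑ β : MultiIdx n m,
    (multiplicity β j : ℝ)⁻¹ • (A (β.succ j)).comp (SymTensor.coeff β)) F = _
  simp only [LinearMap.sum_apply, LinearMap.smul_apply, LinearMap.comp_apply]

theorem snd_linearize_unit (A : HomOp n (m + 1) V W) (j : Fin n) (F : SymTensor n m V)
    (q : Fin n × Fin n × PredIdx n m) :
    (linearize A (MultiIdx.unit j) F).2 q =
      (if q.1 = j then SymTensor.coeff (q.2.2.succ q.2.1) F else 0) -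
        (if q.2.1 = j then SymTensor.coeff (q.2.2.succ q.1) F else 0) := by
  rw [linearize_unit]
  change ((if q.1 = j then SymTensor.coeff (q.2.2.succ q.2.1) else 0) -
    (if q.2.1 = j then SymTensor.coeff (q.2.2.succ q.1) else 0) : SymTensor n m V →ₗ[ℝ] V) F = _
  rw [LinearMap.sub_apply]
  congr 1 <;> split_ifs <;> rfl

theorem symbol_linearize_eq_sum (A : HomOp n (m + 1) V W) (ξ : Eu n) (F : SymTensor n m V) :
    (linearize A).symbol ξ F = ∑ j, ξ j • linearize A (MultiIdx.unit j) F := by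
  simp only [HomOp.symbol, LinearMap.sum_apply, LinearMap.smul_apply]
  rw [sum_multiIdx_one]
  exact Finset.sum_congr rfl fun j _ => congrArg (· • _) (monomial_unit ξ j)

theorem symbol_linearize_apply (A : HomOp n (m + 1) V W) (ξ : Eu n) (F : SymTensor n m V) :
    (linearize A).symbol ξ F =
      (∑ j, ∑ β : MultiIdx n m,
        (multiplicity β j : ℝ)⁻¹ • ξ j • A (β.succ j) (SymTensor.coeff β F),
      fun q => ξ q.1 • SymTensor.coeff (q.2.2.succ q.2.1) F -
        ξ q.2.1 • SymTensor.coeff (q.2.2.succ q.1) F) := by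
  rw [symbol_linearize_eq_sum]
  refine Prod.ext ?_ (funext fun q => ?_)
  · simp only [fst_linearize_unit, Prod.fst_sum, Prod.smul_fst, Finset.smul_sum]
    exact Finset.sum_congr rfl fun j _ => Finset.sum_congr rfl fun β _ => smul_comm _ _ _
  · simp only [snd_linearize_unit, Prod.snd_sum, Prod.smul_snd, Finset.sum_apply, Pi.smul_apply,
      smul_sub, Finset.sum_sub_distrib, smul_ite, smul_zero, Finset.sum_ite_eq, Finset.mem_univ,
      if_true]

theorem linearize_isElliptic_iff (A : HomOp n (m + 1) V W) :
    (linearize A).IsElliptic ↔ A.IsElliptic := by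
  refine forall₂_congr fun ξ hξ => ?_
  have hξ' : (ξ : Fin n → ℝ) ≠ 0 := fun h => hξ (by ext i; simpa using congrFun h i)
  constructor
  · intro h
    refine injective_symbol_of_forall (c := A) hξ' fun F ht hc => ?_
    have hF : SymTensor.ofCoeff F = 0 := by
      apply h
      rw [map_zero, symbol_linearize_apply]
      refine Prod.ext ?_ (funext fun q => ?_)
      · simpa [SymTensor.coeff_ofCoeff] using ht
      · simpa [SymTensor.coeff_ofCoeff, sub_eq_zero] using hc q.1 q.2.1 q.2.2
    funext γ
    rw [← SymTensor.coeff_ofCoeff F γ, hF]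
    rfl
  · intro h
    rw [injective_iff_map_eq_zero]
    intro F hF
    rw [symbol_linearize_apply, Prod.mk_eq_zero] at hF
    have h0 := eq_zero_of_injective_symbol (c := A) hξ' h (F := fun γ => SymTensor.coeff γ F) hF.1
      fun i l β => sub_eq_zero.mp (congrFun hF.2 (i, l, β))
    exact SymTensor.ext_coeff fun γ => congrFun h0 γ

/-- A decomposition `∑ s_i p_i = id` survives base change, so the components `p_i` detect zero. This
lets complexified products and tensor spaces be handled componentwise, without identifying `ℂ ⊗ (X ×
Y)` with a product. -/
theorem eq_zero_of_forall_baseChange_eq_zero {ι X : Type*} [Fintype ι] {Y : ι → Type*}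
    [AddCommGroup X] [Module ℝ X] [∀ i, AddCommGroup (Y i)] [∀ i, Module ℝ (Y i)]
    (p : ∀ i, X →ₗ[ℝ] Y i) (s : ∀ i, Y i →ₗ[ℝ] X) (h : ∑ i, s i ∘ₗ p i = LinearMap.id)
    {x : ℂ ⊗[ℝ] X} (hx : ∀ i, (p i).baseChange ℂ x = 0) : x = 0 := by
  have h1 : (LinearMap.id : X →ₗ[ℝ] X).baseChange ℂ x = x := by
    rw [LinearMap.baseChange_id, LinearMap.id_apply]
  rw [← h1, ← h, ← LinearMap.baseChangeHom_apply, map_sum, LinearMap.sum_apply]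
  refine Finset.sum_eq_zero fun i _ => ?_
  rw [LinearMap.baseChangeHom_apply, LinearMap.baseChange_comp, LinearMap.comp_apply, hx, map_zero]

theorem eq_zero_of_baseChange_fst_snd {ι X Y : Type*} [Fintype ι]
    [AddCommGroup X] [Module ℝ X] [AddCommGroup Y] [Module ℝ Y] {y : ℂ ⊗[ℝ] (X × (ι → Y))}
    (h1 : (LinearMap.fst ℝ X (ι → Y)).baseChange ℂ y = 0)
    (h2 : ∀ q, (LinearMap.proj q ∘ₗ LinearMap.snd ℝ X (ι → Y)).baseChange ℂ y = 0) : y = 0 := by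
  classical
  have h3 : (LinearMap.snd ℝ X (ι → Y)).baseChange ℂ y = 0 := by
    refine eq_zero_of_forall_baseChange_eq_zero (fun q => LinearMap.proj q)
      (fun q => LinearMap.single ℝ (fun _ => Y) q) ?_ fun q => ?_
    · refine LinearMap.ext fun f => funext fun q => ?_
      simp [Finset.sum_apply, Finset.sum_pi_single]
    · rw [← LinearMap.comp_apply, ← LinearMap.baseChange_comp, h2]
  have h4 : LinearMap.inl ℝ X (ι → Y) ∘ₗ LinearMap.fst ℝ X (ι → Y) +
      LinearMap.inr ℝ X (ι → Y) ∘ₗ LinearMap.snd ℝ X (ι → Y) = LinearMap.id := by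
    exact LinearMap.ext fun z => by simp
  have h5 : (LinearMap.id : X × (ι → Y) →ₗ[ℝ] X × (ι → Y)).baseChange ℂ y = y := by
    rw [LinearMap.baseChange_id, LinearMap.id_apply]
  rw [← h5, ← h4, LinearMap.baseChange_add, LinearMap.baseChange_comp, LinearMap.baseChange_comp,
    LinearMap.add_apply, LinearMap.comp_apply, LinearMap.comp_apply, h1, h3]
  simp

variable (V) in
/-- The symmetric tensor with a single nonzero coordinate, at `γ`. -/
def singleCoeff (γ : MultiIdx n m) : V →ₗ[ℝ] SymTensor n m V :=
  (coeffEquiv n m V).symm.toLinearMap ∘ₗ LinearMap.single ℝ (fun _ => V) γ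

theorem coeff_singleCoeff (γ δ : MultiIdx n m) (v : V) :
    SymTensor.coeff γ (singleCoeff V δ v) = (Pi.single δ v : MultiIdx n m → V) γ := by
  rw [← coeffEquiv_apply]
  exact congrFun ((coeffEquiv n m V).apply_symm_apply _) γ

theorem coeff_comp_singleCoeff (γ δ : MultiIdx n m) :
    SymTensor.coeff γ ∘ₗ singleCoeff V δ = if δ = γ then LinearMap.id else 0 := by
  ext v
  rw [LinearMap.comp_apply, coeff_singleCoeff]
  split_ifs with hγ
  · subst hγ; simp
  · simp [Ne.symm hγ]

theorem sum_singleCoeff_comp_coeff :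
    ∑ γ : MultiIdx n m, singleCoeff V γ ∘ₗ SymTensor.coeff γ = LinearMap.id := by
  ext1 F
  refine SymTensor.ext_coeff fun γ => ?_
  simp [coeff_singleCoeff, Finset.sum_pi_single]

theorem fst_symbolC_linearize (A : HomOp n (m + 1) V W) (ξ : Fin n → ℂ)
    (x : ℂ ⊗[ℝ] SymTensor n m V) :
    (LinearMap.fst ℝ W (CurlTarget n m V)).baseChange ℂ ((linearize A).symbolC ξ x) =
      ∑ j, ∑ β : MultiIdx n m, (multiplicity β j : ℂ)⁻¹ • ξ j •
        (A (β.succ j)).baseChange ℂ ((SymTensor.coeff β).baseChange ℂ x) := by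
  simp only [HomOp.symbolC, LinearMap.sum_apply, LinearMap.smul_apply, map_sum, map_smul]
  rw [sum_multiIdx_one]
  refine Finset.sum_congr rfl fun j _ => ?_
  rw [show (∏ i, ξ i ^ (MultiIdx.unit j).1 i) = ξ j from monomial_unit ξ j,
    ← LinearMap.comp_apply, ← LinearMap.baseChange_comp, linearize_unit, LinearMap.fst_prod,
    ← LinearMap.baseChangeHom_apply, map_sum, LinearMap.sum_apply, Finset.smul_sum]
  refine Finset.sum_congr rfl fun β _ => ?_
  rw [map_smul, LinearMap.baseChangeHom_apply, LinearMap.baseChange_comp, LinearMap.smul_apply,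
    LinearMap.comp_apply, smul_comm,
    show (multiplicity β j : ℂ)⁻¹ = ((multiplicity β j : ℝ)⁻¹ : ℝ) by push_cast; rfl]
  rfl

theorem snd_symbolC_linearize (A : HomOp n (m + 1) V W) (ξ : Fin n → ℂ)
    (x : ℂ ⊗[ℝ] SymTensor n m V) (q : Fin n × Fin n × PredIdx n m) :
    (LinearMap.proj q ∘ₗ LinearMap.snd ℝ W (CurlTarget n m V)).baseChange ℂ
        ((linearize A).symbolC ξ x) =
      ξ q.1 • (SymTensor.coeff (q.2.2.succ q.2.1)).baseChange ℂ x -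
        ξ q.2.1 • (SymTensor.coeff (q.2.2.succ q.1)).baseChange ℂ x := by
  simp only [HomOp.symbolC, LinearMap.sum_apply, LinearMap.smul_apply, map_sum, map_smul]
  rw [sum_multiIdx_one]
  have h : ∀ j, (LinearMap.proj q ∘ₗ LinearMap.snd ℝ W (CurlTarget n m V)).baseChange ℂ
      ((linearize A (MultiIdx.unit j)).baseChange ℂ x) =
      (if q.1 = j then (SymTensor.coeff (q.2.2.succ q.2.1)).baseChange ℂ x else 0) -
        (if q.2.1 = j then (SymTensor.coeff (q.2.2.succ q.1)).baseChange ℂ x else 0) := by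
    intro j
    rw [← LinearMap.comp_apply, ← LinearMap.baseChange_comp, linearize_unit, LinearMap.comp_assoc,
      LinearMap.snd_prod, LinearMap.proj_pi, LinearMap.baseChange_sub, LinearMap.sub_apply]
    congr 1 <;> split_ifs <;> simp
  simp only [h, show ∀ j, (∏ i, ξ i ^ (MultiIdx.unit j).1 i) = ξ j from monomial_unit ξ, smul_sub,
    Finset.sum_sub_distrib, smul_ite, smul_zero, Finset.sum_ite_eq, Finset.mem_univ, if_true]

theorem linearize_isCElliptic_iff (A : HomOp n (m + 1) V W) :
    (linearize A).IsCElliptic ↔ A.IsCElliptic := by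
  refine forall₂_congr fun ξ hξ => ?_
  constructor
  · intro h
    refine injective_symbol_of_forall (c := fun α => (A α).baseChange ℂ) hξ fun F ht hc => ?_
    -- The complex tensor with coordinates `F γ`; it replaces `SymTensor.ofCoeff`, which only
    -- accepts coordinates in `V`.
    let x : ℂ ⊗[ℝ] SymTensor n m V := ∑ γ, (singleCoeff V γ).baseChange ℂ (F γ)
    have hcoeff : ∀ γ, (SymTensor.coeff γ).baseChange ℂ x = F γ := by
      intro γ
      simp only [x, map_sum, ← LinearMap.comp_apply, ← LinearMap.baseChange_comp,
        coeff_comp_singleCoeff]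
      rw [Finset.sum_eq_single γ] <;> simp +contextual
    have hx : x = 0 := by
      apply h
      rw [map_zero]
      refine eq_zero_of_baseChange_fst_snd ?_ fun q => ?_
      · rw [fst_symbolC_linearize]
        simpa only [hcoeff] using ht
      · rw [snd_symbolC_linearize, sub_eq_zero]
        simpa only [hcoeff] using hc q.1 q.2.1 q.2.2
    funext γ
    rw [← hcoeff γ, hx, map_zero]
    rfl
  · intro h
    rw [injective_iff_map_eq_zero]
    intro x hx
    have h0 := eq_zero_of_injective_symbol (c := fun α => (A α).baseChange ℂ) hξ h
      (F := fun γ => (SymTensor.coeff γ).baseChange ℂ x)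
      (by rw [← fst_symbolC_linearize, hx, map_zero])
      fun i l β => sub_eq_zero.mp (by
        rw [← snd_symbolC_linearize A ξ x (i, l, β), hx, map_zero])
    exact eq_zero_of_forall_baseChange_eq_zero _ _ sum_singleCoeff_comp_coeff (congrFun h0)

end Elliptic

/-! ### Iterated partial derivatives of Schwartz functions -/

section PartialDerivatives

open SchwartzMap LineDeriv
open scoped ContDiff

variable {n m : ℕ} {X : Type*} [NormedAddCommGroup X] [NormedSpace ℝ X]

/-- The coordinate vector `eᵢ`. -/
abbrev basisVec (i : Fin n) : Eu n := EuclideanSpace.single i (1 : ℝ)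

theorem lineDerivOp_comm (v w : Eu n) (f : 𝓢(Eu n, X)) : ∂_{v} (∂_{w} f) = ∂_{w} (∂_{v} f) := by
  have h : ∀ (a b : Eu n) (x : Eu n), ∂_{a} (∂_{b} f) x = fderiv ℝ (fderiv ℝ f) x a b := by
    intro a b x
    rw [lineDerivOp_apply_eq_fderiv]
    have h1 : ((∂_{b} f : 𝓢(Eu n, X)) : Eu n → X) = fun y => fderiv ℝ f y b :=
      funext fun y => lineDerivOp_apply_eq_fderiv b f y
    have h2 : DifferentiableAt ℝ (fderiv ℝ f) x :=
      ((f.smooth 2).fderiv_right (m := 1) (by norm_num)).differentiable (by norm_num) x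
    rw [h1, fderiv_clm_apply h2 (by fun_prop)]
    simp
  ext x
  rw [h, h]
  exact ((f.smooth 2).contDiffAt.isSymmSndFDerivAt (by simp)).eq v w

/-- The Schwartz function `∂^α f`. -/
def schwartzPartial (α : MultiIdx n m) (f : 𝓢(Eu n, X)) : 𝓢(Eu n, X) :=
  (coordList α.1).foldr (fun i g => ∂_{basisVec i} g) f

theorem foldr_lineDerivOp_congr {l l' : List (Fin n)} (h : l.Perm l') (f : 𝓢(Eu n, X)) :
    l.foldr (fun i g => ∂_{basisVec i} g) f = l'.foldr (fun i g => ∂_{basisVec i} g) f := by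
  have : LeftCommutative (fun (i : Fin n) (g : 𝓢(Eu n, X)) => (∂_{basisVec i} g : 𝓢(Eu n, X))) :=
    ⟨fun i j g => lineDerivOp_comm _ _ g⟩
  exact h.foldr_eq f

theorem coordList_succ_perm (β : MultiIdx n m) (i : Fin n) :
    (coordList (β.succ i).1).Perm (i :: coordList β.1) := by
  rw [List.perm_iff_count]
  intro l
  rw [List.count_cons, count_coordList, count_coordList]
  by_cases h : l = i
  · subst h; simp [MultiIdx.succ]
  · simp [MultiIdx.succ, h, Ne.symm h]

theorem schwartzPartial_succ (β : MultiIdx n m) (i : Fin n) (f : 𝓢(Eu n, X)) :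
    schwartzPartial (β.succ i) f = ∂_{basisVec i} (schwartzPartial β f) :=
  foldr_lineDerivOp_congr (coordList_succ_perm β i) f

/-- Since partial derivatives commute, the extra one may be taken innermost. This form suits
inductions in which the function changes. -/
theorem schwartzPartial_succ' (β : MultiIdx n m) (i : Fin n) (f : 𝓢(Eu n, X)) :
    schwartzPartial (β.succ i) f = schwartzPartial β (∂_{basisVec i} f) := by
  have h := foldr_lineDerivOp_congr
    ((coordList_succ_perm β i).trans (List.perm_append_singleton i _).symm) f
  rwa [List.foldr_append] at h

theorem schwartzPartial_zero (α : MultiIdx n 0) (f : 𝓢(Eu n, X)) : schwartzPartial α f = f := by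
  have h : coordList α.1 = [] := by
    rw [← List.length_eq_zero_iff, coordList_length, α.2]
  simp [schwartzPartial, h]

theorem schwartzPartial_unit (i : Fin n) (f : 𝓢(Eu n, X)) :
    schwartzPartial (MultiIdx.unit i) f = ∂_{basisVec i} f := by
  have h : MultiIdx.unit i = MultiIdx.succ (⟨0, by simp⟩ : MultiIdx n 0) i :=
    Subtype.ext (by simp [MultiIdx.unit, MultiIdx.succ])
  rw [h, schwartzPartial_succ, schwartzPartial_zero]

theorem foldr_lineDerivOp_eq (l : List (Fin n)) (f : 𝓢(Eu n, X)) :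
    l.foldr (fun i g => ∂_{basisVec i} g) f = ∂^{fun p => basisVec (l.get p)} f := by
  induction l with
  | nil => simp
  | cons i l ih =>
    rw [List.foldr_cons, ih]
    exact (iteratedLineDerivOp_succ_left (fun p => basisVec ((i :: l).get p)) f).symm

/-- The bridge between `partialD`, in which weak derivatives are stated, and iterated directional
derivatives, which stay in the Schwartz space and allow induction on the multi-index. -/
theorem schwartzPartial_apply (α : MultiIdx n m) (f : 𝓢(Eu n, X)) (x : Eu n) :
    schwartzPartial α f x = partialD α f x := by
  rw [schwartzPartial, foldr_lineDerivOp_eq, iteratedLineDerivOp_eq_iteratedFDeriv]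
  have h : ∀ (k k' : ℕ) (h : k = k') (v : Fin k → Eu n),
      iteratedFDeriv ℝ k f x v = iteratedFDeriv ℝ k' f x fun p => v (p.cast h.symm) := by
    rintro k _ rfl v
    rfl
  exact h _ _ ((coordList_length α.1).trans α.2) _

theorem integral_schwartzPartial_smul (γ : MultiIdx n m) (f : 𝓢(Eu n, ℝ)) (g : 𝓢(Eu n, X)) :
    ∫ x, f x • schwartzPartial γ g x = (-1 : ℝ) ^ m • ∫ x, schwartzPartial γ f x • g x := by
  induction m generalizing f g with
  | zero => simp [schwartzPartial_zero]
  | succ m ih =>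
    obtain ⟨β, i, rfl⟩ := γ.exists_eq_succ
    rw [schwartzPartial_succ', ih, schwartzPartial_succ,
      integral_smul_lineDerivOp_right_eq_neg_left, pow_succ]
    simp

end PartialDerivatives

/-! ### Test functions and their derivatives -/

section TestFunctions

open SchwartzMap LineDeriv
open scoped ContDiff

variable {n m : ℕ} {Ω : Opens (Eu n)}

/-- A test function as a Schwartz function. -/
def toSchwartz (φ : 𝓓(Ω, ℝ)) : 𝓢(Eu n, ℝ) := φ.hasCompactSupport.toSchwartzMap φ.contDiff

@[simp]
theorem coe_toSchwartz (φ : 𝓓(Ω, ℝ)) : (toSchwartz φ : Eu n → ℝ) = φ := rfl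

/-- A compactly supported Schwartz function as a test function. -/
def ofSchwartz (f : 𝓢(Eu n, ℝ)) (hf : HasCompactSupport f) (hΩ : tsupport f ⊆ Ω) : 𝓓(Ω, ℝ) :=
  ⟨f, f.smooth ⊤, hf, hΩ⟩

@[simp]
theorem coe_ofSchwartz (f : 𝓢(Eu n, ℝ)) (hf : HasCompactSupport f) (hΩ : tsupport f ⊆ Ω) :
    (ofSchwartz f hf hΩ : Eu n → ℝ) = f := rfl

theorem tsupport_schwartzPartial_subset {X : Type*} [NormedAddCommGroup X] [NormedSpace ℝ X]
    (α : MultiIdx n m) (f : 𝓢(Eu n, X)) : tsupport (schwartzPartial α f) ⊆ tsupport f := by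
  rw [schwartzPartial, foldr_lineDerivOp_eq]
  exact tsupport_iteratedLineDerivOp_subset _ f

/-- The test function `∂^α φ`. -/
def testPartial (α : MultiIdx n m) (φ : 𝓓(Ω, ℝ)) : 𝓓(Ω, ℝ) :=
  ofSchwartz (schwartzPartial α (toSchwartz φ))
    (φ.hasCompactSupport.mono' ((subset_tsupport _).trans (tsupport_schwartzPartial_subset α _)))
    ((tsupport_schwartzPartial_subset α _).trans φ.tsupport_subset)

theorem testPartial_apply (α : MultiIdx n m) (φ : 𝓓(Ω, ℝ)) (x : Eu n) :
    testPartial α φ x = partialD α φ x := schwartzPartial_apply α _ x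

theorem integrableOn_test_smul {X : Type*} [NormedAddCommGroup X] [NormedSpace ℝ X]
    {μ : Measure (Eu n)} {g : Eu n → X} (hg : LocallyIntegrableOn g Ω μ) (φ : 𝓓(Ω, ℝ)) :
    IntegrableOn (fun x => φ x • g x) Ω μ :=
  (TestFunction.integrable_bilin (ContinuousLinearMap.lsmul ℝ ℝ) hg φ).integrableOn

theorem partialD_succ_test (β : MultiIdx n m) (i : Fin n) (φ : 𝓓(Ω, ℝ)) (x : Eu n) :
    partialD β (testPartial (MultiIdx.unit i) φ) x = partialD (β.succ i) φ x := by
  have h2 : (testPartial (MultiIdx.unit i) φ : Eu n → ℝ) = (∂_{basisVec i} (toSchwartz φ) :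
      𝓢(Eu n, ℝ)) := by rw [← schwartzPartial_unit]; rfl
  rw [h2, ← schwartzPartial_apply, ← schwartzPartial_succ', schwartzPartial_apply, coe_toSchwartz]

end TestFunctions

/-! ### The linearized operator annihilates and differentiates weak gradients correctly -/

section Represents

variable {n m : ℕ} {Ω : Opens (Eu n)} {X Y V W : Type*}
  [NormedAddCommGroup X] [NormedSpace ℝ X] [FiniteDimensional ℝ X]
  [NormedAddCommGroup Y] [NormedSpace ℝ Y] [FiniteDimensional ℝ Y]
  [NormedAddCommGroup V] [NormedSpace ℝ V] [FiniteDimensional ℝ V]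
  [NormedAddCommGroup W] [NormedSpace ℝ W] [FiniteDimensional ℝ W]

theorem integral_test_smul_linearMap (L : X →ₗ[ℝ] Y) {g : Eu n → X}
    (hg : LocallyIntegrableOn g (Ω : Set (Eu n))) (φ : 𝓓(Ω, ℝ)) :
    ∫ x in (Ω : Set (Eu n)), φ x • L (g x) = L (∫ x in (Ω : Set (Eu n)), φ x • g x) := by
  have := FiniteDimensional.complete ℝ X
  have := FiniteDimensional.complete ℝ Y
  have h := (LinearMap.toContinuousLinearMap L).integral_comp_comm (integrableOn_test_smul hg φ)
  simpa using h

theorem integral_partialD_smul_linearMap {k : ℕ} (L : X →ₗ[ℝ] Y) {g : Eu n → X}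
    (hg : LocallyIntegrableOn g (Ω : Set (Eu n))) (α : MultiIdx n k) (φ : 𝓓(Ω, ℝ)) :
    ∫ x in (Ω : Set (Eu n)), partialD α φ x • L (g x) =
      L (∫ x in (Ω : Set (Eu n)), partialD α φ x • g x) := by
  simp only [← testPartial_apply]
  exact integral_test_smul_linearMap L hg _

theorem integral_pairZero (μ : RadonMeasure Ω W) (φ : Eu n → ℝ) :
    (μ.pairZero X).integral φ = (μ.integral φ, 0) := by
  have := FiniteDimensional.complete ℝ W
  have := FiniteDimensional.complete ℝ (W × X)
  -- `φ` is arbitrary, so the integrand need not be integrable; the embedding `w ↦ (w, 0)` is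
  -- antilipschitz and commutes with the integral in any case.
  have h := ContinuousLinearMap.integral_comp_comm' (μ := μ.base.restrict (Ω : Set (Eu n)))
    (ContinuousLinearMap.inl ℝ W X) (K := 1)
    (AntilipschitzWith.of_le_mul_dist fun x y => by simp [Prod.dist_eq])
    (fun x => φ x • μ.density x)
  simpa [RadonMeasure.integral, RadonMeasure.pairZero] using h

/-- Pulling the constant `A_α` out of the integrals reduces identities for `A u` to linear algebra
on the vectors `∫ ∂^α φ u`. -/
theorem HomOp.represents_iff {k : ℕ} (A : HomOp n k X Y) {u : Eu n → X}
    (hu : LocallyIntegrableOn u (Ω : Set (Eu n))) (μ : RadonMeasure Ω Y) :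
    A.Represents Ω u μ ↔ ∀ φ : 𝓓(Ω, ℝ), μ.integral φ =
      (-1 : ℝ) ^ k • ∑ α : MultiIdx n k, A α (∫ x in (Ω : Set (Eu n)), partialD α φ x • u x) := by
  simp only [HomOp.Represents, integral_partialD_smul_linearMap _ hu]

theorem linearize_represents_iff {A : HomOp n (m + 1) V W} {G : Eu n → SymTensor n m V}
    (hG : LocallyIntegrableOn G (Ω : Set (Eu n))) (μ : RadonMeasure Ω (W × CurlTarget n m V)) :
    (linearize A).Represents Ω G μ ↔ ∀ φ : 𝓓(Ω, ℝ), μ.integral φ =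
      -∑ j, linearize A (MultiIdx.unit j)
        (∫ x in (Ω : Set (Eu n)), partialD (MultiIdx.unit j) φ x • G x) := by
  have h := HomOp.represents_iff (linearize A) hG μ
  simp only [sum_multiIdx_one, pow_one, neg_smul, one_smul] at h
  exact h

theorem IsWeakGrad.represents_linearize {A : HomOp n (m + 1) V W} {u : Eu n → V}
    {G : Eu n → SymTensor n m V} (hu : LocallyIntegrableOn u (Ω : Set (Eu n)))
    (hG : IsWeakGrad Ω u G) {μ : RadonMeasure Ω W} (hμ : A.Represents Ω u μ) :
    (linearize A).Represents Ω G (μ.pairZero (CurlTarget n m V)) := by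
  rw [HomOp.represents_iff _ hu] at hμ
  refine (linearize_represents_iff hG.1 _).mpr fun φ => ?_
  set J : Fin n → SymTensor n m V := fun j =>
    ∫ x in (Ω : Set (Eu n)), partialD (MultiIdx.unit j) φ x • G x with hJ
  set D : MultiIdx n (m + 1) → V := fun α => ∫ x in (Ω : Set (Eu n)), partialD α φ x • u x with hD
  -- The weak gradient is tested against `∂_j φ` instead of `φ`.
  have hcoeff : ∀ j γ, SymTensor.coeff γ (J j) = (-1 : ℝ) ^ m • D (γ.succ j) := by
    intro j γ
    have h := hG.2 γ (testPartial (MultiIdx.unit j) φ)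
    simp only [partialD_succ_test] at h
    rw [integral_test_smul_linearMap _ hG.1] at h
    simp only [testPartial_apply] at h
    exact h
  rw [integral_pairZero, hμ φ]
  refine Prod.ext ?_ (funext fun q => ?_)
  · simp only [Prod.fst_neg, Prod.fst_sum]
    change _ = -∑ j, (linearize A (MultiIdx.unit j) (J j)).1
    simp only [fst_linearize_unit, hcoeff, map_smul]
    rw [sum_multiplicity_inv (K := ℝ) (fun α => (-1 : ℝ) ^ m • A α (D α)), ← Finset.smul_sum,
      pow_succ']
    simp [hD]
  · simp only [Prod.snd_neg, Prod.snd_sum, Pi.neg_apply, Finset.sum_apply]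
    change _ = -∑ j, (linearize A (MultiIdx.unit j) (J j)).2 q
    simp only [snd_linearize_unit, hcoeff, Finset.sum_sub_distrib, Finset.sum_ite_eq,
      Finset.mem_univ, if_true]
    -- The curl component vanishes because mixed derivatives agree: `β + e_l + e_i = β + e_i + e_l`.
    have h : (q.2.2.succ q.2.1).succ q.1 = (q.2.2.succ q.1).succ q.2.1 :=
      Subtype.ext (add_right_comm _ _ _)
    simp [h]

end Represents

/-! ### Jumps across hyperplanes -/

section HalfSpace

open SchwartzMap LineDeriv
open scoped ContDiff

variable {n : ℕ}

/-- The splitting `(t, z) ↦ t ν + z` of `ℝⁿ` along the unit vector `ν`. -/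
def normalSplitting (ν : Eu n) (hν : ‖ν‖ = 1) : (ℝ × (ℝ ∙ ν)ᗮ) ≃L[ℝ] Eu n :=
  LinearEquiv.toContinuousLinearEquiv
    { toFun := fun p => p.1 • ν + p.2
      map_add' := fun p q => by simp only [Prod.fst_add, Prod.snd_add, Submodule.coe_add]; module
      map_smul' := fun c p => by
        simp only [Prod.smul_fst, Prod.smul_snd, Submodule.coe_smul, RingHom.id_apply, smul_eq_mul]
        module
      invFun := fun y => (⟪ν, y⟫, ⟨y - ⟪ν, y⟫ • ν, by
        rw [Submodule.mem_orthogonal_singleton_iff_inner_right, inner_sub_right, inner_smul_right,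
          real_inner_self_eq_norm_sq, hν]
        simp⟩)
      left_inv := fun p => by
        have h : ⟪ν, (p.2 : Eu n)⟫ = 0 :=
          Submodule.mem_orthogonal_singleton_iff_inner_right.mp p.2.2
        have h1 : ⟪ν, p.1 • ν + (p.2 : Eu n)⟫ = p.1 := by
          rw [inner_add_right, inner_smul_right, real_inner_self_eq_norm_sq, hν, h]
          simp
        refine Prod.ext h1 (Subtype.ext ?_)
        simp [h1]
      right_inv := fun y => by simp }

theorem normalSplitting_apply (ν : Eu n) (hν : ‖ν‖ = 1) (p : ℝ × (ℝ ∙ ν)ᗮ) :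
    normalSplitting ν hν p = p.1 • ν + p.2 := rfl

theorem inner_normalSplitting (ν : Eu n) (hν : ‖ν‖ = 1) (p : ℝ × (ℝ ∙ ν)ᗮ) :
    ⟪normalSplitting ν hν p, ν⟫ = p.1 := by
  have h : ⟪(p.2 : Eu n), ν⟫ = 0 :=
    Submodule.mem_orthogonal_singleton_iff_inner_left.mp p.2.2
  rw [normalSplitting_apply, inner_add_left, inner_smul_left, real_inner_self_eq_norm_sq, hν, h]
  simp

/-- The closed half-space `{y · ν ≥ 0}`. -/
def halfSpace (ν : Eu n) : Set (Eu n) := {y | 0 ≤ ⟪y, ν⟫}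

theorem measurableSet_halfSpace (ν : Eu n) : MeasurableSet (halfSpace ν) :=
  (isClosed_le continuous_const (by fun_prop)).measurableSet

/-- The indicator of the half-space is constant along `w`, so its line derivative there is zero;
integrate by parts. No normalization of `ν` is assumed, and `ν = 0` gives the whole space. -/
theorem integral_halfSpace_lineDerivOp_of_orthogonal {ν w : Eu n} (hw : ⟪w, ν⟫ = 0)
    (f : 𝓢(Eu n, ℝ)) : ∫ y in halfSpace ν, ∂_{w} f y = 0 := by
  have hm := measurableSet_halfSpace ν
  have h := integral_bilinear_hasLineDerivAt_right_eq_neg_left_of_integrable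
    (μ := (volume : Measure (Eu n))) (v := w) (B := ContinuousLinearMap.mul ℝ ℝ)
    (f := (halfSpace ν).indicator fun _ => (1 : ℝ)) (f' := fun _ => 0)
    (g := f) (g' := (∂_{w} f : 𝓢(Eu n, ℝ))) (by simp) ?_ ?_ ?_ ?_
  · rw [← integral_indicator hm]
    refine Eq.trans (integral_congr_ae (ae_of_all _ fun y => ?_)) (h.trans (by simp))
    by_cases hy : y ∈ halfSpace ν <;> simp [hy]
  · refine (((∂_{w} f).integrable (μ := volume)).indicator hm).congr (ae_of_all _ fun y => ?_)
    by_cases hy : y ∈ halfSpace ν <;> simp [hy]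
  · refine ((f.integrable (μ := volume)).indicator hm).congr (ae_of_all _ fun y => ?_)
    by_cases hy : y ∈ halfSpace ν <;> simp [hy]
  · intro y _
    have hc : (fun t : ℝ => (halfSpace ν).indicator (fun _ => (1 : ℝ)) (y + t • w)) =
        fun _ => (halfSpace ν).indicator (fun _ => (1 : ℝ)) y := by
      funext t
      have : y + t • w ∈ halfSpace ν ↔ y ∈ halfSpace ν := by
        simp [halfSpace, inner_add_left, inner_smul_left, hw]
      by_cases hy : y ∈ halfSpace ν <;> simp [this, hy]
    rw [HasLineDerivAt, hc]
    exact hasDerivAt_const _ _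
  · exact fun y _ => (f.hasFDerivAt y).hasLineDerivAt w

/-- The derivatives of the characteristic function of a half-space are carried by a locally
finite nonzero measure on the boundary hyperplane. -/
theorem exists_hyperplane_measure (ν : Eu n) (hν : ‖ν‖ = 1) :
    ∃ M : Measure (Eu n), IsLocallyFiniteMeasure M ∧
      (∀ f : 𝓢(Eu n, ℝ), HasCompactSupport f → ∀ v : Eu n,
        ∫ y in halfSpace ν, ∂_{v} f y = -(⟪v, ν⟫ * ∫ y, f y ∂M)) ∧
      ∃ f : 𝓢(Eu n, ℝ), HasCompactSupport f ∧ ∫ y, f y ∂M ≠ 0 := by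
  set K := (ℝ ∙ ν)ᗮ
  obtain ⟨L, hLapply, hLinner⟩ : ∃ L : (ℝ × K) ≃L[ℝ] Eu n,
      (∀ p, L p = p.1 • ν + p.2) ∧ ∀ p, ⟪L p, ν⟫ = p.1 :=
    ⟨normalSplitting ν hν, normalSplitting_apply ν hν, inner_normalSplitting ν hν⟩
  have hLemb : MeasurableEmbedding L := L.toHomeomorph.measurableEmbedding
  -- Uniqueness of Haar measure; only the positivity of `c` matters.
  obtain ⟨c, hc0, hc⟩ : ∃ c : NNReal, 0 < c ∧ (volume : Measure (Eu n)) =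
      c • ((volume : Measure ℝ).prod (volume : Measure K)).map L :=
    ⟨_, Measure.addHaarScalarFactor_pos_of_isAddHaarMeasure _ _,
      Measure.isAddLeftInvariant_eq_smul _ _⟩
  have hemb : Topology.IsClosedEmbedding (fun z : K => (z : Eu n)) :=
    K.closed_of_finiteDimensional.isClosedEmbedding_subtypeVal
  have hint : ∀ f : Eu n → ℝ, Continuous f →
      ∫ y, f y ∂(c • (volume : Measure K).map fun z : K => (z : Eu n)) =
        (c : ℝ) * ∫ z : K, f z := by
    intro f hf
    rw [integral_smul_nnreal_measure, integral_map hemb.continuous.aemeasurable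
      hf.aestronglyMeasurable]
    rfl
  refine ⟨c • (volume : Measure K).map fun z : K => (z : Eu n), ?_, ?_, ?_⟩
  · have hfin : IsFiniteMeasureOnCompacts
        (c • (volume : Measure K).map fun z : K => (z : Eu n)) := by
      refine ⟨fun C hC => ?_⟩
      rw [Measure.smul_apply, Measure.map_apply hemb.continuous.measurable hC.measurableSet]
      exact ENNReal.mul_lt_top ENNReal.coe_lt_top (hemb.isCompact_preimage hC).measure_lt_top
    exact isLocallyFiniteMeasure_of_isFiniteMeasureOnCompacts
  · intro f hf v
    -- In the normal direction, Fubini reduces the claim to `∫_0^∞ g' = -g(0)` on each line parallel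
    -- to `ν`.
    have hnu : ∫ y in halfSpace ν, ∂_{ν} f y = -((c : ℝ) * ∫ z : K, f z) := by
      rw [← integral_indicator (measurableSet_halfSpace ν), hc, integral_smul_nnreal_measure,
        hLemb.integral_map, integral_prod_symm]
      · rw [NNReal.smul_def, smul_eq_mul, ← mul_neg, ← integral_neg]
        congr 2
        funext z
        have hg : ContDiff ℝ 1 fun t : ℝ => f (t • ν + z) :=
          ((f.smooth 1).comp (by fun_prop : ContDiff ℝ 1 fun t : ℝ => t • ν + (z : Eu n)))
        have hgc : HasCompactSupport fun t : ℝ => f (t • ν + z) := by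
          refine hf.comp_isClosedEmbedding (Isometry.isClosedEmbedding ?_)
          refine Isometry.of_dist_eq fun s t => ?_
          rw [dist_add_right, dist_eq_norm, ← sub_smul, norm_smul, hν, mul_one, dist_eq_norm]
        have h1 := hgc.integral_Ioi_deriv_eq hg 0
        rw [zero_smul, zero_add] at h1
        rw [← h1, ← integral_Ici_eq_integral_Ioi, ← integral_indicator measurableSet_Ici]
        congr 1
        funext t
        have hd : deriv (fun t : ℝ => f (t • ν + z)) t = ∂_{ν} f (t • ν + z) := by
          rw [lineDerivOp_apply_eq_fderiv]
          have h2 : HasDerivAt (fun t : ℝ => t • ν + (z : Eu n)) ν t := by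
            simpa using ((hasDerivAt_id t).smul_const ν).add_const (z : Eu n)
          exact ((f.hasFDerivAt _).comp_hasDerivAt t h2).deriv
        have hmem : L (t, z) ∈ halfSpace ν ↔ t ∈ Set.Ici (0 : ℝ) := by
          simp [halfSpace, hLinner]
        by_cases ht : t ∈ Set.Ici (0 : ℝ)
        · rw [Set.indicator_of_mem (hmem.mpr ht), Set.indicator_of_mem ht, hd, hLapply]
        · rw [Set.indicator_of_notMem (mt hmem.mp ht), Set.indicator_of_notMem ht]
      · have hc' : HasCompactSupport (∂_{ν} f : 𝓢(Eu n, ℝ)) :=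
          hf.mono' ((subset_tsupport _).trans (tsupport_lineDerivOp_subset ν f))
        exact (((∂_{ν} f).continuous.comp L.continuous).integrable_of_hasCompactSupport
          (hc'.comp_homeomorph L.toHomeomorph)).indicator
            (hLemb.measurable (measurableSet_halfSpace ν))
    -- A general direction splits into a tangential part, which contributes nothing, and `⟪v, ν⟫`
    -- times the normal one.
    have hv : ⟪v - ⟪v, ν⟫ • ν, ν⟫ = 0 := by
      rw [inner_sub_left, inner_smul_left, real_inner_self_eq_norm_sq, hν]
      simp
    have hdec : ∂_{v} f = ∂_{v - ⟪v, ν⟫ • ν} f + ⟪v, ν⟫ • ∂_{ν} f := by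
      rw [← lineDerivOp_left_smul, ← lineDerivOp_left_add, sub_add_cancel]
    rw [hdec, hint f f.continuous]
    simp only [add_apply, smul_apply]
    have hi : Integrable (fun y => ⟪v, ν⟫ • ∂_{ν} f y) := (SchwartzMap.integrable _).smul ⟪v, ν⟫
    rw [integral_add (SchwartzMap.integrable _).integrableOn hi.integrableOn,
      integral_halfSpace_lineDerivOp_of_orthogonal hv, integral_smul, hnu]
    simp
  · let b : ContDiffBump (0 : Eu n) := default
    refine ⟨b.hasCompactSupport.toSchwartzMap b.contDiff, b.hasCompactSupport, ?_⟩
    rw [hint _ (SchwartzMap.continuous _)]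
    refine mul_ne_zero (NNReal.coe_ne_zero.mpr hc0.ne') (ne_of_gt ?_)
    refine Continuous.integral_pos_of_hasCompactSupport_nonneg_nonzero (x := (0 : K)) ?_ ?_ ?_ ?_
    · exact b.continuous.comp continuous_subtype_val
    · exact b.hasCompactSupport.comp_isClosedEmbedding hemb
    · exact fun z => b.nonneg
    · exact (b.pos_of_mem_ball (by simpa using b.rOut_pos)).ne'

theorem integral_lineDerivOp_eq_zero (v : Eu n) (f : 𝓢(Eu n, ℝ)) : ∫ y, ∂_{v} f y = 0 := by
  have h := integral_halfSpace_lineDerivOp_of_orthogonal (ν := 0) (inner_zero_right v) f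
  simpa [halfSpace] using h

end HalfSpace

/-! ### The linearized operator on piecewise constant maps -/

section Jump

open SchwartzMap LineDeriv

variable {n m : ℕ} {V W : Type*}
  [NormedAddCommGroup V] [NormedSpace ℝ V] [FiniteDimensional ℝ V]
  [NormedAddCommGroup W] [NormedSpace ℝ W] [FiniteDimensional ℝ W]

theorem jumpMap_eq {X : Type*} [AddCommGroup X] (fp fm : X) (ν y : Eu n) :
    jumpMap fp fm ν y = (halfSpace ν).indicator (fun _ => fp - fm) y + fm := by
  by_cases hy : y ∈ halfSpace ν
  · have : 0 ≤ ⟪y, ν⟫ := hy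
    simp [jumpMap, hy, this]
  · have : ¬ 0 ≤ ⟪y, ν⟫ := hy
    simp [jumpMap, hy, this]

theorem locallyIntegrable_jumpMap {X : Type*} [NormedAddCommGroup X] (fp fm : X) (ν : Eu n) :
    LocallyIntegrable (jumpMap fp fm ν) := by
  rw [show jumpMap fp fm ν = fun y => (halfSpace ν).indicator (fun _ => fp - fm) y + fm from
    funext fun y => jumpMap_eq fp fm ν y]
  exact ((locallyIntegrable_const _).indicator (measurableSet_halfSpace ν)).add
    (locallyIntegrable_const _)

/-- The jump map is `fm` plus the indicator of the half-space times `fp - fm`, and a constant has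
zero derivative. -/
theorem integral_lineDerivOp_smul_jumpMap {X : Type*} [NormedAddCommGroup X] [NormedSpace ℝ X]
    [CompleteSpace X] (fp fm : X) (ν v : Eu n) (f : 𝓢(Eu n, ℝ)) :
    ∫ y, ∂_{v} f y • jumpMap fp fm ν y = (∫ y in halfSpace ν, ∂_{v} f y) • (fp - fm) := by
  have hm := measurableSet_halfSpace ν
  have hi : Integrable (fun y => (∂_{v} f y)) := (∂_{v} f).integrable
  have h1 : ∀ y, ∂_{v} f y • jumpMap fp fm ν y =
      (halfSpace ν).indicator (fun y => ∂_{v} f y • (fp - fm)) y + ∂_{v} f y • fm := by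
    intro y
    by_cases hy : y ∈ halfSpace ν <;> simp [jumpMap_eq, hy, smul_sub]
  simp only [h1]
  rw [integral_add ((hi.smul_const _).indicator hm) (hi.smul_const _), integral_indicator hm,
    integral_smul_const, integral_smul_const, integral_lineDerivOp_eq_zero, zero_smul, add_zero]

/-- The normal form of the jump part of `L(A)` of a piecewise constant map. -/
theorem represents_jumpMap_iff (A : HomOp n (m + 1) V W) (fp fm : SymTensor n m V) {ν : Eu n}
    {M : Measure (Eu n)} (hM : ∀ f : 𝓢(Eu n, ℝ), HasCompactSupport f → ∀ v : Eu n,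
      ∫ y in halfSpace ν, ∂_{v} f y = -(⟪v, ν⟫ * ∫ y, f y ∂M))
    (μ : RadonMeasure (⊤ : Opens (Eu n)) W) :
    (linearize A).Represents ⊤ (jumpMap fp fm ν) (μ.pairZero (CurlTarget n m V)) ↔
      ∀ φ : 𝓓((⊤ : Opens (Eu n)), ℝ), (μ.integral φ, (0 : CurlTarget n m V)) =
        (∫ y, φ y ∂M) • (linearize A).symbol ν (fp - fm) := by
  have hloc : LocallyIntegrableOn (jumpMap fp fm ν) ((⊤ : Opens (Eu n)) : Set (Eu n)) :=
    (locallyIntegrable_jumpMap fp fm ν).locallyIntegrableOn _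
  rw [linearize_represents_iff hloc]
  refine forall_congr' fun φ => ?_
  rw [integral_pairZero]
  have hcs : CompleteSpace (SymTensor n m V) := FiniteDimensional.complete ℝ _
  have h : ∀ j, ∫ x in ((⊤ : Opens (Eu n)) : Set (Eu n)),
      partialD (MultiIdx.unit j) φ x • jumpMap fp fm ν x =
        -((∫ y, φ y ∂M) • ν j • (fp - fm)) := by
    intro j
    have h1 : ∀ x, partialD (MultiIdx.unit j) φ x = ∂_{basisVec j} (toSchwartz φ) x := fun x => by
      rw [← schwartzPartial_unit, schwartzPartial_apply, coe_toSchwartz]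
    have h2 := hM (toSchwartz φ) φ.hasCompactSupport (basisVec j)
    rw [EuclideanSpace.inner_single_left] at h2
    simp only [h1, Opens.coe_top, setIntegral_univ]
    rw [integral_lineDerivOp_smul_jumpMap, h2, neg_smul, mul_comm, mul_smul]
    simp
  simp only [h, map_neg, Finset.sum_neg_distrib, neg_neg, map_smul]
  rw [← Finset.smul_sum, ← symbol_linearize_eq_sum]

theorem exists_represents_jumpMap_iff (A : HomOp n (m + 1) V W) (fp fm : SymTensor n m V)
    (ν : Eu n) (hν : ‖ν‖ = 1) :
    (∃ μ : RadonMeasure (⊤ : Opens (Eu n)) W,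
      (linearize A).Represents ⊤ (jumpMap fp fm ν) (μ.pairZero (CurlTarget n m V))) ↔
      ∃ a : V, fp - fm = SymTensor.pure m a ν := by
  obtain ⟨M, hMfin, hM, f, hf, hfM⟩ := exists_hyperplane_measure ν hν
  simp only [represents_jumpMap_iff A fp fm hM, symbol_linearize_apply]
  constructor
  · rintro ⟨μ, hμ⟩
    -- Testing with an `f` whose integral against `M` is nonzero lets the scalar factor be
    -- cancelled.
    have h := (Prod.ext_iff.mp (hμ (ofSchwartz f hf (Set.subset_univ _)))).2
    have hν0 : (ν : Fin n → ℝ) ≠ 0 := by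
      intro h0
      have : ν = 0 := by ext i; exact congrFun h0 i
      simp [this] at hν
    obtain ⟨a, ha⟩ := exists_monomial_smul_of_curl_eq_zero hν0
      (F := fun γ => SymTensor.coeff γ (fp - fm)) (fun i l β => by
        have h1 := congrFun h (i, l, β)
        simp only [Prod.smul_snd, Pi.smul_apply, Pi.zero_apply] at h1
        exact sub_eq_zero.mp ((smul_eq_zero.mp h1.symm).resolve_left hfM))
    exact ⟨a, SymTensor.ext_coeff fun γ => by rw [ha, SymTensor.coeff_pure]⟩
  · rintro ⟨a, ha⟩
    -- The measure is `M` with constant density, the `Ã`-part of the symbol at `ν` applied to `fp -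
    -- fm`.
    refine ⟨⟨M, fun _ => ∑ j, ∑ β : MultiIdx n m,
      (multiplicity β j : ℝ)⁻¹ • ν j • A (β.succ j) (SymTensor.coeff β (fp - fm)), hMfin,
      (locallyIntegrable_const _).locallyIntegrableOn _⟩, fun φ => ?_⟩
    refine Prod.ext ?_ (funext fun q => ?_)
    · have : CompleteSpace W := FiniteDimensional.complete ℝ W
      simp only [RadonMeasure.integral, Opens.coe_top, Measure.restrict_univ]
      rw [integral_smul_const]
      rfl
    · simp only [Prod.smul_snd, Pi.smul_apply, Pi.zero_apply, ha, SymTensor.coeff_pure,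
        PredIdx.succ, monomial_add_single, smul_smul]
      rw [← sub_smul, show ν q.1 * (monomial ν q.2.2.1 * ν q.2.1) -
        ν q.2.1 * (monomial ν q.2.2.1 * ν q.1) = 0 by ring, zero_smul, smul_zero]

end Jump

/-! ### Linearity and dilation of partial derivatives -/

section Dilation

open SchwartzMap LineDeriv

variable {n m : ℕ} {X Y : Type*} [NormedAddCommGroup X] [NormedSpace ℝ X]
  [NormedAddCommGroup Y] [NormedSpace ℝ Y]

theorem schwartzPartial_add (α : MultiIdx n m) (f g : 𝓢(Eu n, X)) :
    schwartzPartial α (f + g) = schwartzPartial α f + schwartzPartial α g := by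
  simp only [schwartzPartial, foldr_lineDerivOp_eq, iteratedLineDerivOp_add]

theorem schwartzPartial_smul (α : MultiIdx n m) (c : ℝ) (f : 𝓢(Eu n, X)) :
    schwartzPartial α (c • f) = c • schwartzPartial α f := by
  simp only [schwartzPartial, foldr_lineDerivOp_eq, iteratedLineDerivOp_smul]

theorem schwartzPartial_sub (α : MultiIdx n m) (f g : 𝓢(Eu n, X)) :
    schwartzPartial α (f - g) = schwartzPartial α f - schwartzPartial α g := by
  rw [sub_eq_add_neg, schwartzPartial_add, ← neg_one_smul ℝ g, schwartzPartial_smul, neg_one_smul,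
    sub_eq_add_neg]

theorem schwartzPartial_postcompCLM (α : MultiIdx n m) (L : X →L[ℝ] Y) (f : 𝓢(Eu n, X)) :
    schwartzPartial α (f.postcompCLM L) = (schwartzPartial α f).postcompCLM L := by
  induction m with
  | zero => simp only [schwartzPartial_zero]
  | succ m ih =>
    obtain ⟨β, i, rfl⟩ := α.exists_eq_succ
    rw [schwartzPartial_succ, schwartzPartial_succ, ih]
    ext x
    have h : HasFDerivAt (fun y => L (schwartzPartial β f y))
        (L ∘L fderiv ℝ (schwartzPartial β f) x) x :=
      L.hasFDerivAt.comp x ((schwartzPartial β f).hasFDerivAt x)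
    rw [postcompCLM_apply, lineDerivOp_apply_eq_fderiv, lineDerivOp_apply_eq_fderiv]
    exact congrArg (· (basisVec i)) h.fderiv

/-- The dilation `f ↦ f (2^N ·)`. -/
def dilate (N : ℕ) : 𝓢(Eu n, X) →L[ℝ] 𝓢(Eu n, X) :=
  compCLMOfContinuousLinearEquiv ℝ
    (ContinuousLinearEquiv.smulLeft (R₁ := ℝ) (M₁ := Eu n)
      (Units.mk0 ((2 : ℝ) ^ N) (by positivity)))

theorem dilate_apply (N : ℕ) (f : 𝓢(Eu n, X)) (x : Eu n) : dilate N f x = f ((2 : ℝ) ^ N • x) :=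
  rfl

theorem schwartzPartial_dilate (α : MultiIdx n m) (N : ℕ) (f : 𝓢(Eu n, X)) :
    schwartzPartial α (dilate N f) = ((2 : ℝ) ^ N) ^ m • dilate N (schwartzPartial α f) := by
  induction m with
  | zero => simp only [schwartzPartial_zero, pow_zero, one_smul]
  | succ m ih =>
    obtain ⟨β, i, rfl⟩ := α.exists_eq_succ
    rw [schwartzPartial_succ, schwartzPartial_succ, ih, lineDerivOp_smul, dilate,
      lineDerivOp_compCLMOfContinuousLinearEquiv, pow_succ, mul_smul]
    congr 1
    rw [← map_smul, ← lineDerivOp_left_smul]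
    rfl

end Dilation

/-! ### A dyadic parametrix of an elliptic operator -/

section Fourier

open SchwartzMap LineDeriv FourierTransform
open scoped ContDiff

variable {n m : ℕ}

theorem fourier_schwartzPartial (α : MultiIdx n m) (f : 𝓢(Eu n, ℂ)) (ξ : Eu n) :
    𝓕 (schwartzPartial α f) ξ =
      (2 * Real.pi * Complex.I) ^ m * (monomial ξ α.1 : ℝ) * 𝓕 f ξ := by
  induction m with
  | zero =>
    have h : α.1 = 0 := funext fun l => by simpa using (Finset.sum_eq_zero_iff.mp α.2) l
    simp [schwartzPartial_zero, monomial, h]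
  | succ m ih =>
    obtain ⟨β, i, rfl⟩ := α.exists_eq_succ
    have ht : (fun x : Eu n => ⟪x, basisVec i⟫).HasTemperateGrowth :=
      ((innerSL ℝ).flip (basisVec i)).hasTemperateGrowth
    rw [schwartzPartial_succ, fourier_lineDerivOp_eq, smul_apply, smulLeftCLM_apply_apply ht, ih]
    simp only [MultiIdx.succ, monomial_add_single, EuclideanSpace.inner_single_right, smul_eq_mul,
      Complex.real_smul, pow_succ]
    push_cast
    simp
    ring

/-- The substitution `ξ ↦ 2ξ` in the inversion integral; it turns the dyadic difference of `X` into
a difference of cutoffs on the Fourier side. -/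
theorem fourierInv_dilate (f g : 𝓢(Eu n, ℂ)) (h : ∀ ξ, g ((2 : ℝ) • ξ) = f ξ) :
    𝓕⁻ g = (2 : ℝ) ^ n • dilate 1 (𝓕⁻ f) := by
  ext x
  rw [smul_apply, dilate_apply, fourierInv_coe, fourierInv_coe, Real.fourierInv_eq',
    Real.fourierInv_eq']
  have h1 := Measure.integral_comp_smul (volume : Measure (Eu n))
    (fun ξ => Complex.exp (↑(2 * Real.pi * ⟪ξ, x⟫) * Complex.I) • g ξ) (2 : ℝ)
  simp only [finrank_euclideanSpace, Fintype.card_fin, h] at h1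
  have h2 : ((2 : ℝ) ^ n) • |((2 : ℝ) ^ n)⁻¹| •
      ∫ ξ : Eu n, Complex.exp (↑(2 * Real.pi * ⟪ξ, x⟫) * Complex.I) • g ξ =
      ∫ ξ : Eu n, Complex.exp (↑(2 * Real.pi * ⟪ξ, x⟫) * Complex.I) • g ξ := by
    rw [smul_smul, abs_of_pos (by positivity), mul_inv_cancel₀ (by positivity), one_smul]
  rw [← h2, ← h1]
  simp only [inner_smul_left, inner_smul_right, pow_one]
  rfl

variable {V W : Type*}
  [NormedAddCommGroup V] [InnerProductSpace ℝ V] [FiniteDimensional ℝ V]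
  [NormedAddCommGroup W] [InnerProductSpace ℝ W] [FiniteDimensional ℝ W]

theorem contDiff_monomial (α : Fin n → ℕ) : ContDiff ℝ ∞ fun ξ : Eu n => monomial (ξ : Fin n → ℝ) α := by
  unfold monomial
  exact contDiff_prod fun i _ => by fun_prop

/-- A smooth left inverse of an elliptic symbol, localized by `ψ` away from the origin. -/
theorem exists_smooth_left_inverse {A : HomOp n m V W} (hA : A.IsElliptic)
    {ψ : Eu n → ℝ} (hψ : ContDiff ℝ ∞ ψ) (h0 : ∀ᶠ ξ in nhds 0, ψ ξ = 0) :
    ∃ M : Eu n → (W →L[ℝ] V), ContDiff ℝ ∞ M ∧ (∀ ξ, ψ ξ = 0 → M ξ = 0) ∧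
      ∀ ξ v, M ξ (A.symbol ξ v) = ψ ξ • v := by
  have hcV := FiniteDimensional.complete ℝ V
  have hcW := FiniteDimensional.complete ℝ W
  let B : Eu n → (V →L[ℝ] W) := fun ξ =>
    ∑ α : MultiIdx n m, monomial (ξ : Fin n → ℝ) α.1 • LinearMap.toContinuousLinearMap (A α)
  let B' : Eu n → (W →L[ℝ] V) := fun ξ => ∑ α : MultiIdx n m, monomial (ξ : Fin n → ℝ) α.1 •
    ContinuousLinearMap.adjoint (LinearMap.toContinuousLinearMap (A α))
  have hB : ∀ ξ v, B ξ v = A.symbol ξ v := fun ξ v => by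
    simp [B, HomOp.symbol, monomial, LinearMap.sum_apply]
  have hBsmooth : ContDiff ℝ ∞ B :=
    ContDiff.sum fun α _ => (contDiff_monomial α.1).smul contDiff_const
  have hB'smooth : ContDiff ℝ ∞ B' :=
    ContDiff.sum fun α _ => (contDiff_monomial α.1).smul contDiff_const
  have hadj : ∀ ξ v w, ⟪B' ξ w, v⟫ = ⟪w, B ξ v⟫ := fun ξ v w => by
    simp only [B, B', sum_apply, smul_apply, sum_inner,
      inner_sum, inner_smul_left, inner_smul_right, ContinuousLinearMap.adjoint_inner_left]
    rfl
  -- `S = 𝔸(ξ)* 𝔸(ξ)` is invertible for `ξ ≠ 0` by ellipticity, so `S⁻¹ 𝔸(ξ)*` is a left inverse of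
  -- the symbol.
  let S : Eu n → (V →L[ℝ] V) := fun ξ => B' ξ ∘L B ξ
  have hSsmooth : ContDiff ℝ ∞ S := hB'smooth.clm_comp hBsmooth
  have hSunit : ∀ ξ, ξ ≠ 0 → IsUnit (S ξ) := fun ξ hξ => by
    have hinj : Function.Injective (S ξ : V →ₗ[ℝ] V) := by
      rw [injective_iff_map_eq_zero]
      intro v hv
      have h1 : ⟪B ξ v, B ξ v⟫ = 0 := by
        rw [← hadj]
        change ⟪S ξ v, v⟫ = 0
        rw [show S ξ v = 0 from hv, inner_zero_left]
      apply hA ξ hξ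
      rw [map_zero, ← hB]
      exact inner_self_eq_zero.mp h1
    exact ContinuousLinearMap.isUnit_iff_bijective.mpr
      ⟨hinj, LinearMap.injective_iff_surjective.mp hinj⟩
  -- `Ring.inverse` is zero at non-units, which can occur only at `ξ = 0`; there `ψ` vanishes on a
  -- neighbourhood, so smoothness is not affected.
  refine ⟨fun ξ => ψ ξ • (Ring.inverse (S ξ) ∘L B' ξ), ?_, fun ξ h => by simp [h], fun ξ v => ?_⟩
  · rw [contDiff_iff_contDiffAt]
    intro ξ
    rcases eq_or_ne ξ 0 with rfl | hξ
    · refine contDiffAt_const (c := (0 : W →L[ℝ] V)) |>.congr_of_eventuallyEq ?_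
      filter_upwards [h0] with ξ hξ
      simp [hξ]
    · obtain ⟨u, hu⟩ := hSunit ξ hξ
      have hinv : ContDiffAt ℝ ∞ (fun ξ => Ring.inverse (S ξ)) ξ := by
        have h3 := contDiffAt_ringInverse ℝ (n := ∞) u
        rw [hu] at h3
        exact h3.comp ξ hSsmooth.contDiffAt
      exact hψ.contDiffAt.smul (hinv.clm_comp hB'smooth.contDiffAt)
  · rcases eq_or_ne ξ 0 with rfl | hξ
    · simp [h0.self_of_nhds]
    · have h4 : Ring.inverse (S ξ) (S ξ v) = v := by
        have := Ring.inverse_mul_cancel _ (hSunit ξ hξ)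
        exact congrArg (· v) this
      rw [← hB]
      change ψ ξ • Ring.inverse (S ξ) (S ξ v) = _
      rw [h4]

/-- The Schwartz function `ξ ↦ f ξ`, regarded as complex valued. -/
def toComplexSchwartz (f : Eu n → ℝ) (hf : ContDiff ℝ ∞ f) (hc : HasCompactSupport f) :
    𝓢(Eu n, ℂ) :=
  (hc.toSchwartzMap hf).postcompCLM Complex.ofRealCLM

theorem toComplexSchwartz_apply {f : Eu n → ℝ} (hf : ContDiff ℝ ∞ f) (hc : HasCompactSupport f)
    (ξ : Eu n) : toComplexSchwartz f hf hc ξ = f ξ := rfl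

/-- The dyadic difference `2^n X(2 ·) - X`. -/
def dyadicDiff {Y : Type*} [NormedAddCommGroup Y] [NormedSpace ℝ Y] (X : 𝓢(Eu n, Y)) :
    𝓢(Eu n, Y) := (2 : ℝ) ^ n • dilate 1 X - X

/-- On the Fourier side this is `M(ξ) 𝔸(ξ) = ψ(ξ) ξ^γ`, with `ψ` the difference of two dyadic
cutoffs. The `q t` come from the coordinates of `M` in a basis `b t` of `W →L[ℝ] V`. -/
theorem exists_dyadic_parametrix {A : HomOp n (m + 1) V W} (hA : A.IsElliptic)
    (γ : MultiIdx n m) :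
    ∃ (X : 𝓢(Eu n, ℝ)) (d : ℕ) (q : Fin d → 𝓢(Eu n, ℝ)) (b : Fin d → (W →ₗ[ℝ] V)),
      ∫ x, X x = 1 ∧ ∀ x v, ∑ t, ∑ α, schwartzPartial α (q t) x • b t (A α v) =
        schwartzPartial γ (dyadicDiff X) x • v := by
  let χ : ContDiffBump (0 : Eu n) := ⟨1, 2, one_pos, one_lt_two⟩
  have hχ2c : HasCompactSupport fun ξ : Eu n => χ ((2 : ℝ)⁻¹ • ξ) :=
    χ.hasCompactSupport.comp_smul (by norm_num)
  have hχ2 : ContDiff ℝ ∞ fun ξ : Eu n => χ ((2 : ℝ)⁻¹ • ξ) := χ.contDiff.comp (by fun_prop)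
  let ψ : Eu n → ℝ := fun ξ => χ ((2 : ℝ)⁻¹ • ξ) - χ ξ
  have hψ : ContDiff ℝ ∞ ψ := hχ2.sub χ.contDiff
  have hψ0 : ∀ᶠ ξ in nhds 0, ψ ξ = 0 := by
    filter_upwards [Metric.ball_mem_nhds (0 : Eu n) one_pos] with ξ hξ
    have h1 : ‖ξ‖ < 1 := by simpa using hξ
    simp only [ψ]
    rw [χ.one_of_mem_closedBall, χ.one_of_mem_closedBall, sub_self]
    · simpa using h1.le
    · simp only [Metric.mem_closedBall, dist_zero_right, norm_smul]
      norm_num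
      change 1 / 2 * ‖ξ‖ ≤ 1
      linarith
  have hψc : HasCompactSupport ψ := hχ2c.sub χ.hasCompactSupport
  have hψγ : ContDiff ℝ ∞ fun ξ => ψ ξ * monomial (ξ : Fin n → ℝ) γ.1 :=
    hψ.mul (contDiff_monomial γ.1)
  obtain ⟨M, hM, hMsupp, hMA⟩ := exists_smooth_left_inverse hA hψγ
    (hψ0.mono fun ξ h => by rw [h, zero_mul])
  have hMc : HasCompactSupport M := hψc.mono fun ξ hξ h => hξ (hMsupp ξ (by rw [h, zero_mul]))
  let bas := Module.finBasis ℝ (W →L[ℝ] V)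
  let mt : Fin (Module.finrank ℝ (W →L[ℝ] V)) → Eu n → ℝ := fun t ξ => bas.coord t (M ξ)
  have hmt : ∀ t, ContDiff ℝ ∞ (mt t) := fun t =>
    (LinearMap.toContinuousLinearMap (bas.coord t)).contDiff.comp hM
  have hmtc : ∀ t, HasCompactSupport (mt t) := fun t =>
    hMc.comp_left (g := bas.coord t) (map_zero _)
  let XC : 𝓢(Eu n, ℂ) := 𝓕⁻ (toComplexSchwartz χ χ.contDiff χ.hasCompactSupport)
  -- Derivatives of order `m + 1` produce `c ^ (m + 1)` and `∂^γ` only `c ^ m`; the factor `c⁻¹` in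
  -- `qC` balances them.
  let c : ℂ := 2 * Real.pi * Complex.I
  have hc : c ≠ 0 := Complex.two_pi_I_ne_zero
  let qC : Fin (Module.finrank ℝ (W →L[ℝ] V)) → 𝓢(Eu n, ℂ) := fun t =>
    c⁻¹ • 𝓕⁻ (toComplexSchwartz (mt t) (hmt t) (hmtc t))
  have hdd : dyadicDiff XC = 𝓕⁻ (toComplexSchwartz ψ hψ hψc) := by
    have h1 : toComplexSchwartz ψ hψ hψc = toComplexSchwartz _ hχ2 hχ2c -
        toComplexSchwartz χ χ.contDiff χ.hasCompactSupport := by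
      ext ξ
      simp [toComplexSchwartz_apply, ψ]
    have h2 := fourierInv_dilate (toComplexSchwartz χ χ.contDiff χ.hasCompactSupport)
      (toComplexSchwartz _ hχ2 hχ2c) fun ξ => by
        simp [toComplexSchwartz_apply, smul_smul]
    rw [h1, sub_eq_add_neg, FourierTransform.fourierInv_add, FourierTransform.fourierInv_neg, h2,
      ← sub_eq_add_neg]
    rfl
  have hre : ∀ f : 𝓢(Eu n, ℂ), dyadicDiff (f.postcompCLM Complex.reCLM) =
      (dyadicDiff f).postcompCLM Complex.reCLM := fun f => by
    ext x
    simp [dyadicDiff, dilate_apply]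
  -- Pairing with `w` makes the identity scalar with real coefficients, so that taking real parts at
  -- the end preserves it.
  have key : ∀ v w, ∑ t, ∑ α, ((⟪w, bas t (A α v)⟫ : ℝ) : ℂ) • schwartzPartial α (qC t) =
      ((⟪w, v⟫ : ℝ) : ℂ) • schwartzPartial γ (dyadicDiff XC) := by
    intro v w
    have hinj : Function.Injective (fun f : 𝓢(Eu n, ℂ) => 𝓕 f) :=
      Function.LeftInverse.injective (g := fun f => 𝓕⁻ f) fun f => FourierTransform.fourierInv_fourier_eq f
    apply hinj
    ext ξ
    have hL : ∀ f : 𝓢(Eu n, ℂ), 𝓕 f = fourierTransformCLM ℂ f := fun _ => rfl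
    simp only [hL, map_sum, map_smul]
    simp only [← hL, sum_apply, smul_apply, fourier_schwartzPartial, smul_eq_mul, hdd,
      FourierTransform.fourier_fourierInv_eq, qC, FourierTransform.fourier_smul,
      toComplexSchwartz_apply]
    have h3 : ∑ t, ∑ α, (⟪w, bas t (A α v)⟫ * monomial (ξ : Fin n → ℝ) α.1 * mt t ξ) =
        ⟪w, v⟫ * (ψ ξ * monomial (ξ : Fin n → ℝ) γ.1) := by
      have h4 : M ξ = ∑ t, mt t ξ • bas t := (bas.sum_repr (M ξ)).symm
      have h5 := hMA ξ v
      rw [h4] at h5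
      have h6 := congrArg (fun z : V => ⟪w, z⟫) h5
      simp only [sum_apply, smul_apply, inner_sum, inner_smul_right, HomOp.symbol,
        LinearMap.sum_apply, LinearMap.smul_apply, map_sum, map_smul] at h6
      rw [mul_comm ⟪w, v⟫, ← h6, Finset.sum_comm]
      refine Finset.sum_congr rfl fun α _ => ?_
      rw [Finset.mul_sum]
      refine Finset.sum_congr rfl fun t _ => ?_
      rw [monomial]
      ring
    have h7 := congrArg (fun r : ℝ => c ^ m * (r : ℂ)) h3
    simp only [Complex.ofReal_sum, Complex.ofReal_mul, Finset.mul_sum] at h7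
    refine Eq.trans ?_ (h7.trans ?_)
    · refine Finset.sum_congr rfl fun t _ => Finset.sum_congr rfl fun α _ => ?_
      change _ * (c ^ (m + 1) * _ * (c⁻¹ * _)) = _
      field_simp
      ring
    · change _ = _ * (c ^ m * _ * _)
      ring
  refine ⟨XC.postcompCLM Complex.reCLM, _, fun t => (qC t).postcompCLM Complex.reCLM,
    fun t => (bas t : W →ₗ[ℝ] V), ?_, fun x v => ?_⟩
  · have h1 : 𝓕 XC 0 = 1 := by
      simp only [XC, FourierTransform.fourier_fourierInv_eq, toComplexSchwartz_apply]
      rw [χ.one_of_mem_closedBall (by simp [χ.rIn_pos.le])]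
      simp
    rw [fourier_coe, Real.fourier_eq'] at h1
    simp only [inner_zero_right, mul_zero, Complex.ofReal_zero, zero_mul, Complex.exp_zero,
      one_smul] at h1
    have h2 := Complex.reCLM.integral_comp_comm (XC.integrable (μ := volume))
    rw [h1] at h2
    simpa using h2
  · refine ext_inner_left ℝ fun w => ?_
    have h := congrArg Complex.re (congrArg (fun f : 𝓢(Eu n, ℂ) => f x) (key v w))
    simp only [hre, schwartzPartial_postcompCLM, postcompCLM_apply, inner_sum, inner_smul_right]
    simp only [sum_apply, smul_apply, smul_eq_mul, Complex.re_sum, Complex.re_ofReal_mul] at h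
    simpa [mul_comm] using h

end Fourier

/-! ### Localization of dilated Schwartz functions -/

section Localization

open SchwartzMap LineDeriv
open scoped ContDiff

variable {n m : ℕ}

/-- The product of two scalar Schwartz functions. -/
def schwartzMul (f g : 𝓢(Eu n, ℝ)) : 𝓢(Eu n, ℝ) :=
  pairing (ContinuousLinearMap.mul ℝ ℝ) f g

theorem schwartzMul_apply (f g : 𝓢(Eu n, ℝ)) (x : Eu n) : schwartzMul f g x = f x * g x := rfl

theorem lineDerivOp_schwartzMul (v : Eu n) (f g : 𝓢(Eu n, ℝ)) :
    ∂_{v} (schwartzMul f g) = schwartzMul (∂_{v} f) g + schwartzMul f (∂_{v} g) := by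
  ext x
  have h : HasFDerivAt (fun y => f y * g y) (f x • fderiv ℝ g x + g x • fderiv ℝ f x) x :=
    (f.hasFDerivAt x).mul (g.hasFDerivAt x)
  rw [lineDerivOp_apply_eq_fderiv, add_apply, schwartzMul_apply, schwartzMul_apply,
    lineDerivOp_apply_eq_fderiv, lineDerivOp_apply_eq_fderiv]
  refine (congrArg (· v) h.fderiv).trans ?_
  simp only [add_apply, smul_apply, smul_eq_mul]
  ring

theorem schwartzMul_smul (c : ℝ) (f g : 𝓢(Eu n, ℝ)) :
    schwartzMul f (c • g) = c • schwartzMul f g := by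
  ext x
  simp only [schwartzMul_apply, smul_apply, smul_eq_mul]
  ring

theorem schwartzMul_sub (f g h : 𝓢(Eu n, ℝ)) :
    schwartzMul f (g - h) = schwartzMul f g - schwartzMul f h := by
  ext x
  simp only [schwartzMul_apply, sub_apply]
  ring

theorem exists_bound_dilate (f : 𝓢(Eu n, ℝ)) {r : ℝ} (hr : 0 < r) (l : ℕ) :
    ∃ C, 0 ≤ C ∧ ∀ N x, r ≤ ‖x‖ → |dilate N f x| ≤ C * (((2 : ℝ) ^ N)⁻¹) ^ l := by
  refine ⟨SchwartzMap.seminorm ℝ l 0 f * r⁻¹ ^ l, by positivity, fun N x hx => ?_⟩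
  have h := f.norm_pow_mul_le_seminorm ℝ l ((2 : ℝ) ^ N • x)
  have hp : (0 : ℝ) < 2 ^ N := by positivity
  rw [norm_smul, norm_pow, Real.norm_ofNat, mul_pow] at h
  have h1 : ((2 : ℝ) ^ N) ^ l * r ^ l * |dilate N f x| ≤ SchwartzMap.seminorm ℝ l 0 f := by
    refine le_trans ?_ h
    rw [dilate_apply, ← Real.norm_eq_abs]
    gcongr
  rw [inv_pow, inv_pow, ← div_eq_mul_inv, ← div_eq_mul_inv, div_div, le_div_iff₀ (by positivity)]
  linarith

/-- Away from the origin the dilates decay faster than any power of `2^{-N}`, and this absorbs the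
factors `2^N` produced by differentiating. -/
theorem exists_bound_schwartzPartial_mul_dilate (α : MultiIdx n m) (g f : 𝓢(Eu n, ℝ)) {r : ℝ}
    (hr : 0 < r) (l : ℕ) :
    ∃ C, 0 ≤ C ∧ ∀ N x, r ≤ ‖x‖ →
      |schwartzPartial α (schwartzMul g (dilate N f)) x| ≤ C * (((2 : ℝ) ^ N)⁻¹) ^ l := by
  induction m generalizing g f l with
  | zero =>
    obtain ⟨C, hC, h⟩ := exists_bound_dilate f hr l
    refine ⟨SchwartzMap.seminorm ℝ 0 0 g * C, by positivity, fun N x hx => ?_⟩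
    rw [schwartzPartial_zero, schwartzMul_apply, abs_mul, mul_assoc]
    exact mul_le_mul (g.norm_le_seminorm ℝ x) (h N x hx) (abs_nonneg _) (by positivity)
  | succ m ih =>
    obtain ⟨β, i, rfl⟩ := α.exists_eq_succ
    obtain ⟨C₁, hC₁, h₁⟩ := ih β (∂_{basisVec i} g) f l
    -- One extra power of decay pays for the derivative that falls on the dilate.
    obtain ⟨C₂, hC₂, h₂⟩ := ih β g (∂_{basisVec i} f) (l + 1)
    refine ⟨C₁ + C₂, by positivity, fun N x hx => ?_⟩
    have hd : ∂_{basisVec i} (dilate N f) = (2 : ℝ) ^ N • dilate N (∂_{basisVec i} f) := by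
      have h := schwartzPartial_dilate (MultiIdx.unit i) N f
      rwa [schwartzPartial_unit, schwartzPartial_unit, pow_one] at h
    rw [schwartzPartial_succ', lineDerivOp_schwartzMul, schwartzPartial_add, hd, schwartzMul_smul,
      schwartzPartial_smul, add_apply, smul_apply, smul_eq_mul, add_mul]
    refine (abs_add_le _ _).trans (add_le_add (h₁ N x hx) ?_)
    have hp : (0 : ℝ) < 2 ^ N := by positivity
    rw [abs_mul, abs_of_pos hp]
    calc (2 : ℝ) ^ N * _ ≤ 2 ^ N * (C₂ * (((2 : ℝ) ^ N)⁻¹) ^ (l + 1)) := by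
          gcongr
          exact h₂ N x hx
      _ = _ := by rw [pow_succ]; field_simp

theorem schwartzPartial_eq_of_eqOn (α : MultiIdx n m) {f g : 𝓢(Eu n, ℝ)} {U : Set (Eu n)}
    (hU : IsOpen U) (h : Set.EqOn f g U) {x : Eu n} (hx : x ∈ U) :
    schwartzPartial α f x = schwartzPartial α g x := by
  have he : (f : Eu n → ℝ) =ᶠ[nhds x] g := Filter.eventuallyEq_of_mem (hU.mem_nhds hx) h
  rw [schwartzPartial_apply, schwartzPartial_apply, partialD, partialD,
    (he.iteratedFDeriv ℝ m).eq_of_nhds]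

/-- The mass-preserving rescaling `2^{Nn} f(2^N ·)`. -/
def rescale (N : ℕ) (f : 𝓢(Eu n, ℝ)) : 𝓢(Eu n, ℝ) := ((2 : ℝ) ^ N) ^ n • dilate N f

theorem rescale_apply (N : ℕ) (f : 𝓢(Eu n, ℝ)) (x : Eu n) :
    rescale N f x = ((2 : ℝ) ^ N) ^ n * f ((2 : ℝ) ^ N • x) := rfl

theorem schwartzPartial_rescale (α : MultiIdx n m) (N : ℕ) (f : 𝓢(Eu n, ℝ)) :
    schwartzPartial α (rescale N f) = ((2 : ℝ) ^ N) ^ m • rescale N (schwartzPartial α f) := by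
  rw [rescale, schwartzPartial_smul, schwartzPartial_dilate, smul_comm, rescale]

theorem rescale_succ_sub (N : ℕ) (f : 𝓢(Eu n, ℝ)) :
    rescale (N + 1) f - rescale N f = rescale N (dyadicDiff f) := by
  ext x
  simp only [sub_apply, rescale_apply, dyadicDiff, smul_apply, dilate_apply, smul_eq_mul, smul_smul]
  rw [pow_succ' (2 : ℝ) N, pow_one, mul_pow]
  ring

theorem integral_comp_rescale {E : Type*} [NormedAddCommGroup E] [NormedSpace ℝ E]
    (N : ℕ) (h : Eu n → E) :
    ∫ x, ((2 : ℝ) ^ N) ^ n • h ((2 : ℝ) ^ N • x) = ∫ x, h x := by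
  have hp : (0 : ℝ) < ((2 : ℝ) ^ N) ^ n := by positivity
  rw [integral_smul, Measure.integral_comp_smul, finrank_euclideanSpace, Fintype.card_fin,
    abs_inv, abs_of_pos hp, smul_smul, mul_inv_cancel₀ hp.ne', one_smul]

theorem integral_abs_rescale (N : ℕ) (f : 𝓢(Eu n, ℝ)) : ∫ x, |rescale N f x| = ∫ x, |f x| := by
  rw [← integral_comp_rescale N fun x => |f x|]
  simp only [rescale_apply, abs_mul, smul_eq_mul]
  congr 1
  funext x
  rw [abs_of_pos (by positivity)]

/-- A cutoff function which equals `1` near the origin. -/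
theorem exists_cutoff {ε : ℝ} (hε : 0 < ε) :
    ∃ θ : 𝓢(Eu n, ℝ), (∀ x ∈ Metric.ball (0 : Eu n) (ε / 2), θ x = 1) ∧ (∀ x, |θ x| ≤ 1) ∧
      tsupport θ ⊆ Metric.closedBall 0 ε := by
  let b : ContDiffBump (0 : Eu n) := ⟨ε / 2, ε, by positivity, by linarith⟩
  refine ⟨b.hasCompactSupport.toSchwartzMap b.contDiff, fun x hx => ?_, fun x => ?_, ?_⟩
  · exact b.one_of_mem_closedBall (Metric.ball_subset_closedBall hx)
  · change |b x| ≤ 1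
    rw [abs_of_nonneg b.nonneg]
    exact b.le_one
  · exact b.tsupport_eq.subset

theorem tsupport_schwartzMul_subset (f g : 𝓢(Eu n, ℝ)) :
    tsupport (schwartzMul f g) ⊆ tsupport f :=
  closure_mono fun x hx h => hx (by rw [schwartzMul_apply, h, zero_mul])

/-- Localized rescalings of a function of integral one form an approximate identity. -/
theorem tendsto_integral_mul_rescale {θ X : 𝓢(Eu n, ℝ)} (hθ0 : θ 0 = 1) (hθ : ∀ x, |θ x| ≤ 1)
    (hX : ∫ x, X x = 1) {h : Eu n → ℝ} (hc : Continuous h) {B : ℝ} (hB : ∀ x, |h x| ≤ B) :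
    Filter.Tendsto (fun N => ∫ z, h z * schwartzMul θ (rescale N X) z) Filter.atTop
      (nhds (h 0)) := by
  have hB0 : 0 ≤ B := (abs_nonneg _).trans (hB 0)
  have h1 : ∀ N : ℕ, ∫ z, h z * schwartzMul θ (rescale N X) z =
      ∫ z, h (((2 : ℝ) ^ N)⁻¹ • z) * θ (((2 : ℝ) ^ N)⁻¹ • z) * X z := by
    intro N
    rw [← integral_comp_rescale N
      fun z => h (((2 : ℝ) ^ N)⁻¹ • z) * θ (((2 : ℝ) ^ N)⁻¹ • z) * X z]
    congr 1
    funext z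
    have hp : (0 : ℝ) < (2 : ℝ) ^ N := by positivity
    rw [smul_smul, inv_mul_cancel₀ hp.ne', one_smul, schwartzMul_apply, rescale_apply, smul_eq_mul]
    ring
  simp only [h1]
  have h2 : h 0 = ∫ z, h 0 * θ 0 * X z := by
    rw [integral_const_mul, hX, hθ0, mul_one, mul_one]
  rw [h2]
  refine tendsto_integral_of_dominated_convergence (fun z => B * |X z|) (fun N => ?_)
    ((X.integrable (μ := volume)).abs.const_mul B) (fun N => ae_of_all _ fun z => ?_)
    (ae_of_all _ fun z => ?_)
  · exact Continuous.aestronglyMeasurable (by fun_prop)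
  · rw [Real.norm_eq_abs, abs_mul, abs_mul]
    gcongr
    calc _ ≤ B * 1 := mul_le_mul (hB _) (hθ _) (abs_nonneg _) hB0
      _ = B := mul_one B
  · have h3 : Filter.Tendsto (fun N : ℕ => ((2 : ℝ) ^ N)⁻¹ • z) Filter.atTop (nhds 0) := by
      have h4 : Filter.Tendsto (fun N : ℕ => ((2 : ℝ) ^ N)⁻¹) Filter.atTop (nhds 0) := by
        simp only [← inv_pow]
        exact tendsto_pow_atTop_nhds_zero_of_lt_one (by norm_num) (by norm_num)
      simpa using h4.smul_const z
    exact (((hc.tendsto 0).comp h3).mul ((θ.continuous.tendsto 0).comp h3)).mul_const _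

end Localization

/-! ### The localized parametrix -/

section Reflection

open SchwartzMap LineDeriv

variable {n m : ℕ}

/-- The function `y ↦ f (x - y)`. -/
def reflectAt (x : Eu n) (f : 𝓢(Eu n, ℝ)) : 𝓢(Eu n, ℝ) :=
  compSubConstCLM ℝ x (compCLMOfContinuousLinearEquiv ℝ (ContinuousLinearEquiv.neg ℝ) f)

theorem reflectAt_apply (x y : Eu n) (f : 𝓢(Eu n, ℝ)) : reflectAt x f y = f (x - y) := by
  simp [reflectAt]

theorem lineDerivOp_reflectAt (x v : Eu n) (f : 𝓢(Eu n, ℝ)) :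
    ∂_{v} (reflectAt x f) = -reflectAt x (∂_{v} f) := by
  ext y
  have h : HasFDerivAt (reflectAt x f) (-(fderiv ℝ f (x - y))) y := by
    have h1 : HasFDerivAt (fun y : Eu n => x - y) (-ContinuousLinearMap.id ℝ (Eu n)) y := by
      simpa using (hasFDerivAt_id y).const_sub x
    have h2 := (f.hasFDerivAt (x - y)).comp y h1
    have h3 : (reflectAt x f : Eu n → ℝ) = f ∘ fun y => x - y :=
      funext fun y => reflectAt_apply x y f
    rw [h3]
    simpa using h2
  rw [lineDerivOp_apply_eq_fderiv, h.fderiv, neg_apply, neg_apply, reflectAt_apply,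
    lineDerivOp_apply_eq_fderiv]

theorem schwartzPartial_reflectAt (α : MultiIdx n m) (x : Eu n) (f : 𝓢(Eu n, ℝ)) :
    schwartzPartial α (reflectAt x f) = (-1 : ℝ) ^ m • reflectAt x (schwartzPartial α f) := by
  induction m with
  | zero => simp [schwartzPartial_zero]
  | succ m ih =>
    obtain ⟨β, i, rfl⟩ := α.exists_eq_succ
    rw [schwartzPartial_succ, schwartzPartial_succ, ih, lineDerivOp_smul, lineDerivOp_reflectAt,
      pow_succ]
    simp

theorem tsupport_reflectAt_subset {f : 𝓢(Eu n, ℝ)} {ε : ℝ}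
    (hf : tsupport f ⊆ Metric.closedBall 0 ε) (x : Eu n) :
    tsupport (reflectAt x f) ⊆ Metric.closedBall x ε := by
  refine closure_minimal (fun y hy => ?_) Metric.isClosed_closedBall
  have h1 : f (x - y) ≠ 0 := by rwa [← reflectAt_apply]
  have h2 := hf (subset_tsupport _ h1)
  rwa [mem_closedBall_zero_iff, ← dist_eq_norm, dist_comm] at h2

theorem integrable_reflectAt_smul {Y : Type*} [NormedAddCommGroup Y] [NormedSpace ℝ Y]
    {μ : Measure (Eu n)} {u : Eu n → Y} (hu : Integrable u μ) (x : Eu n) (f : 𝓢(Eu n, ℝ)) :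
    Integrable (fun y => f (x - y) • u y) μ :=
  hu.bdd_smul (SchwartzMap.seminorm ℝ 0 0 f)
    (Continuous.aestronglyMeasurable (by fun_prop))
    (ae_of_all _ fun y => f.norm_le_seminorm ℝ (x - y))

end Reflection

/-! ### Kernel and error estimates -/

section Parametrix

open SchwartzMap LineDeriv

variable {n m d : ℕ} {V W : Type*}
  [NormedAddCommGroup V] [InnerProductSpace ℝ V] [FiniteDimensional ℝ V]
  [NormedAddCommGroup W] [InnerProductSpace ℝ W]

/-- The localized rescaling `θ · 2^{-N} 2^{Nn} f(2^N ·)`. -/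
def localRescale (θ f : 𝓢(Eu n, ℝ)) (N : ℕ) : 𝓢(Eu n, ℝ) :=
  schwartzMul θ (((2 : ℝ) ^ N)⁻¹ • rescale N f)

theorem integral_abs_localRescale_le {θ : 𝓢(Eu n, ℝ)} (hθ : ∀ x, |θ x| ≤ 1) (f : 𝓢(Eu n, ℝ))
    (N : ℕ) : ∫ x, |localRescale θ f N x| ≤ ((2 : ℝ) ^ N)⁻¹ * ∫ x, |f x| := by
  rw [← integral_abs_rescale N f, ← integral_const_mul]
  refine integral_mono (SchwartzMap.integrable _).abs
    ((SchwartzMap.integrable _).abs.const_mul _) fun x => ?_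
  simp only [localRescale, schwartzMul_apply, smul_apply, smul_eq_mul]
  have hp : (0 : ℝ) < ((2 : ℝ) ^ N)⁻¹ := by positivity
  rw [abs_mul, abs_mul, abs_of_pos hp]
  exact mul_le_of_le_one_left (by positivity) (hθ x)

theorem exists_bound_schwartzPartial_mul_rescale (α : MultiIdx n m) (θ f : 𝓢(Eu n, ℝ)) {r : ℝ}
    (hr : 0 < r) :
    ∃ C, 0 ≤ C ∧ ∀ N x, r ≤ ‖x‖ →
      |schwartzPartial α (schwartzMul θ (rescale N f)) x| ≤ C * ((2 : ℝ) ^ N)⁻¹ := by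
  -- Of the `n + 1` powers, `n` pay for the mass normalization and one remains.
  obtain ⟨C, hC, h⟩ := exists_bound_schwartzPartial_mul_dilate α θ f hr (n + 1)
  refine ⟨C, hC, fun N x hx => ?_⟩
  have hp : (0 : ℝ) < ((2 : ℝ) ^ N) ^ n := by positivity
  rw [rescale, schwartzMul_smul, schwartzPartial_smul, smul_apply, smul_eq_mul, abs_mul,
    abs_of_pos hp]
  calc _ ≤ ((2 : ℝ) ^ N) ^ n * (C * (((2 : ℝ) ^ N)⁻¹) ^ (n + 1)) := by
        gcongr
        exact h N x hx
    _ = _ := by rw [pow_succ, inv_pow]; field_simp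

theorem exists_bound_schwartzPartial_localRescale (α : MultiIdx n m) (θ f : 𝓢(Eu n, ℝ)) {r : ℝ}
    (hr : 0 < r) :
    ∃ C, 0 ≤ C ∧ ∀ N x, r ≤ ‖x‖ →
      |schwartzPartial α (localRescale θ f N) x| ≤ C * ((2 : ℝ) ^ N)⁻¹ := by
  obtain ⟨C, hC, h⟩ := exists_bound_schwartzPartial_mul_rescale α θ f hr
  refine ⟨C, hC, fun N x hx => ?_⟩
  have hp : (0 : ℝ) < ((2 : ℝ) ^ N)⁻¹ := by positivity
  rw [localRescale, schwartzMul_smul, schwartzPartial_smul, smul_apply, smul_eq_mul, abs_mul,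
    abs_of_pos hp]
  refine le_trans (mul_le_of_le_one_left (abs_nonneg _) ?_) (h N x hx)
  exact inv_le_one_of_one_le₀ (one_le_pow₀ one_le_two)

/-- The localized dyadic kernel. -/
def localKernel [FiniteDimensional ℝ W] (θ : 𝓢(Eu n, ℝ))
    (q : Fin d → 𝓢(Eu n, ℝ)) (b : Fin d → (W →ₗ[ℝ] V)) (N : ℕ) (x : Eu n) : W →L[ℝ] V :=
  ∑ t, localRescale θ (q t) N x • LinearMap.toContinuousLinearMap (b t)

/-- The error made by the localized dyadic kernel. -/
def localError (A : HomOp n (m + 1) V W) (γ : MultiIdx n m) (θ X : 𝓢(Eu n, ℝ))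
    (q : Fin d → 𝓢(Eu n, ℝ)) (b : Fin d → (W →ₗ[ℝ] V)) (N : ℕ) (x : Eu n) : V →L[ℝ] V :=
  schwartzPartial γ (schwartzMul θ (rescale N (dyadicDiff X))) x • ContinuousLinearMap.id ℝ V -
    ∑ t, ∑ α, schwartzPartial α (localRescale θ (q t) N) x •
      LinearMap.toContinuousLinearMap (b t ∘ₗ A α)

theorem continuous_localKernel [FiniteDimensional ℝ W] (θ : 𝓢(Eu n, ℝ)) (q : Fin d → 𝓢(Eu n, ℝ))
    (b : Fin d → (W →ₗ[ℝ] V)) (N : ℕ) : Continuous (localKernel θ q b N) := by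
  unfold localKernel
  fun_prop

theorem norm_localKernel_le [FiniteDimensional ℝ W] (θ : 𝓢(Eu n, ℝ)) (q : Fin d → 𝓢(Eu n, ℝ))
    (b : Fin d → (W →ₗ[ℝ] V)) (N : ℕ) (x : Eu n) : ‖localKernel θ q b N x‖ ≤
      ∑ t, |localRescale θ (q t) N x| * ‖LinearMap.toContinuousLinearMap (b t)‖ := by
  refine (norm_sum_le _ _).trans (Finset.sum_le_sum fun t _ => ?_)
  rw [norm_smul, Real.norm_eq_abs]

theorem integrable_localKernel [FiniteDimensional ℝ W] (θ : 𝓢(Eu n, ℝ)) (q : Fin d → 𝓢(Eu n, ℝ))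
    (b : Fin d → (W →ₗ[ℝ] V)) (N : ℕ) : Integrable (localKernel θ q b N) := by
  have hi : ∀ t, Integrable fun x => |localRescale θ (q t) N x| *
      ‖LinearMap.toContinuousLinearMap (b t)‖ := fun t =>
    (SchwartzMap.integrable _).abs.mul_const _
  exact (integrable_finsetSum Finset.univ fun t _ => hi t).mono'
    (continuous_localKernel θ q b N).aestronglyMeasurable
    (ae_of_all _ (norm_localKernel_le θ q b N))

/-- `rescale` preserves `L¹` norms and `θ` does not increase them, so the prefactor `2^{-N}` in
`localRescale` survives. -/
theorem exists_integral_norm_localKernel_le [FiniteDimensional ℝ W] {θ : 𝓢(Eu n, ℝ)}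
    (hθ : ∀ x, |θ x| ≤ 1) (q : Fin d → 𝓢(Eu n, ℝ)) (b : Fin d → (W →ₗ[ℝ] V)) :
    ∃ C, 0 ≤ C ∧ ∀ N, ∫ x, ‖localKernel θ q b N x‖ ≤ C * ((2 : ℝ) ^ N)⁻¹ := by
  refine ⟨∑ t, (∫ x, |q t x|) * ‖LinearMap.toContinuousLinearMap (b t)‖,
    Finset.sum_nonneg fun t _ => mul_nonneg (integral_nonneg fun x => abs_nonneg _)
      (norm_nonneg _), fun N => ?_⟩
  have hi : ∀ t, Integrable fun x => |localRescale θ (q t) N x| *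
      ‖LinearMap.toContinuousLinearMap (b t)‖ := fun t =>
    (SchwartzMap.integrable _).abs.mul_const _
  calc ∫ x, ‖localKernel θ q b N x‖
      ≤ ∫ x, ∑ t, |localRescale θ (q t) N x| * ‖LinearMap.toContinuousLinearMap (b t)‖ := by
        refine integral_mono (integrable_localKernel θ q b N).norm
          (integrable_finsetSum _ fun t _ => hi t) (norm_localKernel_le θ q b N)
    _ = ∑ t, (∫ x, |localRescale θ (q t) N x|) * ‖LinearMap.toContinuousLinearMap (b t)‖ := by
        rw [integral_finsetSum _ fun t _ => hi t]
        simp only [integral_mul_const]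
    _ ≤ _ := by
        rw [Finset.sum_mul]
        refine Finset.sum_le_sum fun t _ => ?_
        rw [mul_right_comm, mul_comm (∫ x, |q t x|)]
        gcongr
        exact integral_abs_localRescale_le hθ (q t) N

theorem continuous_localError (A : HomOp n (m + 1) V W) (γ : MultiIdx n m) (θ X : 𝓢(Eu n, ℝ))
    (q : Fin d → 𝓢(Eu n, ℝ)) (b : Fin d → (W →ₗ[ℝ] V)) (N : ℕ) :
    Continuous (localError A γ θ X q b N) := by
  unfold localError
  fun_prop

section Cutoff

variable {A : HomOp n (m + 1) V W} {γ : MultiIdx n m} {θ X : 𝓢(Eu n, ℝ)} {ε : ℝ}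
  {q : Fin d → 𝓢(Eu n, ℝ)} {b : Fin d → (W →ₗ[ℝ] V)}

/-- Where `θ = 1` the cutoff disappears, and the parametrix identity holds at every scale: both
sides pick up `2^{N(m + n)}`, as `2^{-N}` offsets the additional derivative. -/
theorem localError_eq_zero_of_mem_ball (hθ : ∀ x ∈ Metric.ball (0 : Eu n) (ε / 2), θ x = 1)
    (h : ∀ x v, ∑ t, ∑ α, schwartzPartial α (q t) x • b t (A α v) =
      schwartzPartial γ (dyadicDiff X) x • v) (N : ℕ) {x : Eu n}
    (hx : x ∈ Metric.ball (0 : Eu n) (ε / 2)) : localError A γ θ X q b N x = 0 := by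
  have hmul : ∀ {k : ℕ} (α : MultiIdx n k) (f : 𝓢(Eu n, ℝ)),
      schwartzPartial α (schwartzMul θ f) x = schwartzPartial α f x := fun α f =>
    schwartzPartial_eq_of_eqOn α Metric.isOpen_ball
      (fun y hy => by rw [schwartzMul_apply, hθ y hy, one_mul]) hx
  ext v
  have h1 := congrArg (fun w => (((2 : ℝ) ^ N) ^ m * ((2 : ℝ) ^ N) ^ n) • w) (h ((2 : ℝ) ^ N • x) v)
  simp only [Finset.smul_sum, smul_smul] at h1
  simp only [localError, localRescale, hmul, schwartzPartial_smul, schwartzPartial_rescale,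
    sub_apply, sum_apply, smul_apply, ContinuousLinearMap.id_apply, zero_apply,
    LinearMap.coe_toContinuousLinearMap', LinearMap.comp_apply, rescale_apply, smul_eq_mul]
  rw [sub_eq_zero, ← mul_assoc, ← h1]
  refine Finset.sum_congr rfl fun t _ => Finset.sum_congr rfl fun α _ => ?_
  congr 1
  rw [pow_succ]
  field_simp

theorem localError_eq_zero_of_notMem (hθ : tsupport θ ⊆ Metric.closedBall 0 ε) (N : ℕ) {x : Eu n}
    (hx : x ∉ Metric.closedBall (0 : Eu n) ε) : localError A γ θ X q b N x = 0 := by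
  have hmul : ∀ {k : ℕ} (α : MultiIdx n k) (f : 𝓢(Eu n, ℝ)),
      schwartzPartial α (schwartzMul θ f) x = 0 := fun α f =>
    image_eq_zero_of_notMem_tsupport fun hx' =>
      hx (hθ (tsupport_schwartzMul_subset _ _ (tsupport_schwartzPartial_subset _ _ hx')))
  simp [localError, localRescale, hmul]

theorem integrable_localError (hθ : tsupport θ ⊆ Metric.closedBall 0 ε) (N : ℕ) :
    Integrable (localError A γ θ X q b N) :=
  (continuous_localError A γ θ X q b N).integrable_of_hasCompactSupport
    (HasCompactSupport.intro (isCompact_closedBall 0 ε)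
      fun _ hx => localError_eq_zero_of_notMem hθ N hx)

/-- The error vanishes inside radius `ε / 2` and outside radius `ε`; in between, Schwartz decay
bounds it uniformly, and the volume is finite. -/
theorem exists_integral_norm_localError_le (hε : 0 < ε)
    (hθ1 : ∀ x ∈ Metric.ball (0 : Eu n) (ε / 2), θ x = 1)
    (hθ : tsupport θ ⊆ Metric.closedBall 0 ε)
    (h : ∀ x v, ∑ t, ∑ α, schwartzPartial α (q t) x • b t (A α v) =
      schwartzPartial γ (dyadicDiff X) x • v) :
    ∃ C, 0 ≤ C ∧ ∀ N, ∫ x, ‖localError A γ θ X q b N x‖ ≤ C * ((2 : ℝ) ^ N)⁻¹ := by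
  obtain ⟨C₀, hC₀, h₀⟩ := exists_bound_schwartzPartial_mul_rescale γ θ (dyadicDiff X)
    (half_pos hε)
  choose C₁ hC₁ h₁ using fun (t : Fin d) (α : MultiIdx n (m + 1)) =>
    exists_bound_schwartzPartial_localRescale α θ (q t) (half_pos hε)
  let C := C₀ * ‖ContinuousLinearMap.id ℝ V‖ +
    ∑ t, ∑ α, C₁ t α * ‖LinearMap.toContinuousLinearMap (b t ∘ₗ A α)‖
  have hC : 0 ≤ C := add_nonneg (mul_nonneg hC₀ (norm_nonneg _)) (Finset.sum_nonneg fun t _ =>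
    Finset.sum_nonneg fun α _ => mul_nonneg (hC₁ t α) (norm_nonneg _))
  have hbound : ∀ N x, ‖localError A γ θ X q b N x‖ ≤ C * ((2 : ℝ) ^ N)⁻¹ := by
    intro N x
    by_cases hx : x ∈ Metric.ball (0 : Eu n) (ε / 2)
    · rw [localError_eq_zero_of_mem_ball hθ1 h N hx, norm_zero]
      positivity
    · have hx' : ε / 2 ≤ ‖x‖ := by simpa using hx
      rw [localError, add_mul, Finset.sum_mul]
      refine (norm_sub_le _ _).trans (add_le_add ?_ ((norm_sum_le _ _).trans
        (Finset.sum_le_sum fun t _ => ?_)))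
      · rw [norm_smul, mul_right_comm]
        gcongr
        exact h₀ N x hx'
      · rw [Finset.sum_mul]
        refine (norm_sum_le _ _).trans (Finset.sum_le_sum fun α _ => ?_)
        rw [norm_smul, mul_right_comm]
        gcongr
        exact h₁ t α N x hx'
  refine ⟨C * volume.real (Metric.closedBall (0 : Eu n) ε), by positivity, fun N => ?_⟩
  rw [← setIntegral_eq_integral_of_forall_compl_eq_zero (s := Metric.closedBall (0 : Eu n) ε)
    fun x hx => by rw [localError_eq_zero_of_notMem hθ N hx, norm_zero]]
  refine (setIntegral_mono_on (integrable_localError hθ N).norm.integrableOn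
    (integrableOn_const (C := C * ((2 : ℝ) ^ N)⁻¹) measure_closedBall_lt_top.ne)
    measurableSet_closedBall fun x _ => hbound N x).trans ?_
  rw [setIntegral_const, smul_eq_mul]
  exact le_of_eq (by ring)

/-- Test `A u = μ` with `y ↦ localRescale θ (q t) N (x - y)`, admissible because its support lies in
the closed `ε`-ball about `x`. By construction of `localError`, only the increment of the mollified
derivative from scale `N` to `N + 1` remains. -/
theorem localKernel_add_localError [FiniteDimensional ℝ W] (hθ : tsupport θ ⊆ Metric.closedBall 0 ε)
    {Ω : Opens (Eu n)} {u : Eu n → V} (hu : IntegrableOn u (Ω : Set (Eu n)))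
    {μ : RadonMeasure Ω W} (hμ : A.Represents Ω u μ) (N : ℕ) {x : Eu n}
    (hx : Metric.closedBall x ε ⊆ Ω) :
    ∫ y in (Ω : Set (Eu n)), localKernel θ q b N (x - y) (μ.density y) ∂μ.base +
      ∫ y in (Ω : Set (Eu n)), localError A γ θ X q b N (x - y) (u y) =
      (∫ y in (Ω : Set (Eu n)),
        schwartzPartial γ (schwartzMul θ (rescale (N + 1) X)) (x - y) • u y) -
      ∫ y in (Ω : Set (Eu n)),
        schwartzPartial γ (schwartzMul θ (rescale N X)) (x - y) • u y := by
  have hcV := FiniteDimensional.complete ℝ V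
  have hcW := FiniteDimensional.complete ℝ W
  have hsupp : ∀ t, tsupport (reflectAt x (localRescale θ (q t) N)) ⊆ Metric.closedBall x ε :=
    fun t => tsupport_reflectAt_subset ((tsupport_schwartzMul_subset _ _).trans hθ) x
  let φ : Fin d → 𝓓(Ω, ℝ) := fun t => ofSchwartz (reflectAt x (localRescale θ (q t) N))
    (HasCompactSupport.of_support_subset_isCompact (isCompact_closedBall x ε)
      ((subset_tsupport _).trans (hsupp t))) ((hsupp t).trans hx)
  have hφ : ∀ t y, φ t y = localRescale θ (q t) N (x - y) := fun t y =>
    reflectAt_apply x y (localRescale θ (q t) N)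
  have hint : ∀ (f : 𝓢(Eu n, ℝ)) (L : V →ₗ[ℝ] V),
      IntegrableOn (fun y => f (x - y) • L (u y)) (Ω : Set (Eu n)) := fun f L =>
    integrable_reflectAt_smul ((LinearMap.toContinuousLinearMap L).integrable_comp hu) x f
  have h1 : ∀ t, ∫ y in (Ω : Set (Eu n)), φ t y • b t (μ.density y) ∂μ.base =
      ∑ α, ∫ y in (Ω : Set (Eu n)),
        schwartzPartial α (localRescale θ (q t) N) (x - y) • b t (A α (u y)) := by
    intro t
    have h2 := (LinearMap.toContinuousLinearMap (b t)).integral_comp_comm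
      (integrableOn_test_smul μ.locallyIntegrable (φ t))
    simp only [LinearMap.coe_toContinuousLinearMap', map_smul] at h2
    rw [h2]
    have h3 := hμ (φ t)
    rw [RadonMeasure.integral] at h3
    rw [h3, map_smul, map_sum, Finset.smul_sum]
    refine Finset.sum_congr rfl fun α _ => ?_
    have h4 : ∀ y, partialD α (φ t) y =
        (-1 : ℝ) ^ (m + 1) * schwartzPartial α (localRescale θ (q t) N) (x - y) := fun y => by
      have h5 : partialD α (φ t) y =
          schwartzPartial α (reflectAt x (localRescale θ (q t) N)) y :=
        (schwartzPartial_apply _ _ _).symm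
      rw [h5, schwartzPartial_reflectAt, smul_apply, reflectAt_apply, smul_eq_mul]
    have h6 := (LinearMap.toContinuousLinearMap (b t)).integral_comp_comm
      (integrable_reflectAt_smul ((LinearMap.toContinuousLinearMap (A α)).integrable_comp hu) x
        (schwartzPartial α (localRescale θ (q t) N)))
    simp only [LinearMap.coe_toContinuousLinearMap', map_smul] at h6
    simp only [h4, mul_smul, integral_smul, map_smul]
    -- The sign from the distributional adjoint cancels the one from the reflection.
    rw [h6, smul_smul, ← pow_add, Even.neg_one_pow (by simp), one_smul]
  have h7 : ∫ y in (Ω : Set (Eu n)), localKernel θ q b N (x - y) (μ.density y) ∂μ.base =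
      ∑ t, ∫ y in (Ω : Set (Eu n)), φ t y • b t (μ.density y) ∂μ.base := by
    rw [← integral_finsetSum]
    · simp [localKernel, sum_apply, hφ]
    · intro t _
      have h8 := (LinearMap.toContinuousLinearMap (b t)).integrable_comp
        (integrableOn_test_smul μ.locallyIntegrable (φ t))
      simpa using h8
  have h9 : ∫ y in (Ω : Set (Eu n)), localError A γ θ X q b N (x - y) (u y) =
      (∫ y in (Ω : Set (Eu n)),
        schwartzPartial γ (schwartzMul θ (rescale N (dyadicDiff X))) (x - y) • u y) -
      ∑ t, ∑ α, ∫ y in (Ω : Set (Eu n)),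
        schwartzPartial α (localRescale θ (q t) N) (x - y) • b t (A α (u y)) := by
    simp only [localError, sub_apply, sum_apply, smul_apply, ContinuousLinearMap.id_apply,
      LinearMap.coe_toContinuousLinearMap', LinearMap.comp_apply]
    rw [integral_sub (integrable_reflectAt_smul hu x _), integral_finsetSum]
    · congr 1
      refine Finset.sum_congr rfl fun t _ => integral_finsetSum _ fun α _ => ?_
      exact hint _ (b t ∘ₗ A α)
    · exact fun t _ => integrable_finsetSum _ fun α _ => hint _ (b t ∘ₗ A α)
    · exact integrable_finsetSum _ fun t _ => integrable_finsetSum _ fun α _ =>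
        hint _ (b t ∘ₗ A α)
  rw [h7, h9, Finset.sum_congr rfl fun t _ => h1 t, add_sub_cancel, ← integral_sub
    (integrable_reflectAt_smul hu x _) (integrable_reflectAt_smul hu x _), ← rescale_succ_sub,
    schwartzMul_sub, schwartzPartial_sub]
  simp only [sub_apply, sub_smul]

end Cutoff

end Parametrix

/-! ### Convolutions with measures -/

section Young

variable {n : ℕ} {Y Z : Type*} [NormedAddCommGroup Y] [NormedSpace ℝ Y]
  [NormedAddCommGroup Z] [NormedSpace ℝ Z] {μ : Measure (Eu n)} [SFinite μ]
  {κ : Eu n → (Y →L[ℝ] Z)} {σ : Eu n → Y}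

theorem integrable_prod_kernel (hc : Continuous κ) (hκ : Integrable κ) (hσ : Integrable σ μ) :
    Integrable (fun p : Eu n × Eu n => κ (p.1 - p.2) (σ p.2)) (volume.prod μ) := by
  have hmeas : AEStronglyMeasurable (fun p : Eu n × Eu n => κ (p.1 - p.2) (σ p.2))
      (volume.prod μ) := by
    have h1 : AEStronglyMeasurable (fun p : Eu n × Eu n => κ (p.1 - p.2)) (volume.prod μ) :=
      (hc.comp (continuous_fst.sub continuous_snd)).aestronglyMeasurable
    exact ((ContinuousLinearMap.apply ℝ Z).aestronglyMeasurable_comp₂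
      hσ.aestronglyMeasurable.comp_snd h1)
  have hnorm : Integrable (fun p : Eu n × Eu n => ‖κ (p.1 - p.2)‖ * ‖σ p.2‖) (volume.prod μ) := by
    have h2 : AEStronglyMeasurable (fun p : Eu n × Eu n => ‖κ (p.1 - p.2)‖ * ‖σ p.2‖)
        (volume.prod μ) :=
      (hc.comp (continuous_fst.sub continuous_snd)).norm.aestronglyMeasurable.mul
        hσ.aestronglyMeasurable.norm.comp_snd
    rw [integrable_prod_iff' h2]
    refine ⟨ae_of_all _ fun y => (hκ.norm.comp_sub_right y).mul_const ‖σ y‖, ?_⟩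
    have h3 : ∀ y, ∫ x, ‖‖κ (x - y)‖ * ‖σ y‖‖ = (∫ x, ‖κ x‖) * ‖σ y‖ := fun y => by
      simp only [norm_mul, norm_norm]
      rw [integral_mul_const, integral_sub_right_eq_self fun x => ‖κ x‖]
    simp only [h3]
    exact hσ.norm.const_mul _
  exact hnorm.mono' hmeas (ae_of_all _ fun p => (κ (p.1 - p.2)).le_opNorm _)

theorem integrable_kernel (hc : Continuous κ) (hκ : Integrable κ) (hσ : Integrable σ μ) :
    Integrable fun x => ∫ y, κ (x - y) (σ y) ∂μ :=
  (integrable_prod_kernel hc hκ hσ).integral_prod_left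

/-- Young's inequality, by Tonelli and translation invariance. The measure is any s-finite one, so
that it applies both to `u dx` and to `A u`. -/
theorem integral_norm_kernel_le (hc : Continuous κ) (hκ : Integrable κ) (hσ : Integrable σ μ) :
    ∫ x, ‖∫ y, κ (x - y) (σ y) ∂μ‖ ≤ (∫ x, ‖κ x‖) * ∫ y, ‖σ y‖ ∂μ := by
  have h := integrable_prod_kernel hc hκ hσ
  calc ∫ x, ‖∫ y, κ (x - y) (σ y) ∂μ‖
      ≤ ∫ x, ∫ y, ‖κ (x - y) (σ y)‖ ∂μ :=
        integral_mono h.integral_prod_left.norm h.norm.integral_prod_left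
          fun x => norm_integral_le_integral_norm _
    _ = ∫ y, ∫ x, ‖κ (x - y) (σ y)‖ ∂volume ∂μ :=
        integral_integral_swap (f := fun x y => ‖κ (x - y) (σ y)‖) h.norm
    _ ≤ ∫ y, (∫ x, ‖κ x‖) * ‖σ y‖ ∂μ := by
        refine integral_mono_ae h.norm.integral_prod_right (hσ.norm.const_mul _) ?_
        filter_upwards [h.norm.prod_left_ae] with y hy
        have h3 : (∫ x, ‖κ x‖) * ‖σ y‖ = ∫ x, ‖κ (x - y)‖ * ‖σ y‖ := by
          rw [integral_mul_const, integral_sub_right_eq_self fun x => ‖κ x‖]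
        rw [h3]
        exact integral_mono hy ((hκ.norm.comp_sub_right y).mul_const _)
          fun x => (κ (x - y)).le_opNorm _
    _ = _ := integral_const_mul _ _

theorem integrable_tsum_of_summable_integral_norm {α E : Type*} [MeasurableSpace α]
    [NormedAddCommGroup E] [NormedSpace ℝ E] [CompleteSpace E] {μ : Measure α} {F : ℕ → α → E}
    (hF : ∀ i, Integrable (F i) μ) (hs : Summable fun i => ∫ a, ‖F i a‖ ∂μ) :
    Integrable (fun a => ∑' i, F i a) μ := by
  have hmeas : ∀ i, AEMeasurable (fun a => ‖F i a‖ₑ) μ := fun i =>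
    (hF i).aestronglyMeasurable.enorm
  have hfin : ∫⁻ a, ∑' i, ‖F i a‖ₑ ∂μ ≠ ⊤ := by
    rw [lintegral_tsum hmeas]
    have h1 : ∀ i, ∫⁻ a, ‖F i a‖ₑ ∂μ = ENNReal.ofReal (∫ a, ‖F i a‖ ∂μ) := fun i =>
      (ofReal_integral_norm_eq_lintegral_enorm (hF i)).symm
    simp only [h1]
    rw [← ENNReal.ofReal_tsum_of_nonneg (fun i => integral_nonneg fun a => norm_nonneg _) hs]
    exact ENNReal.ofReal_ne_top
  have hsum : ∀ᵐ a ∂μ, Summable fun i => F i a := by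
    filter_upwards [ae_lt_top' (AEMeasurable.tsum hmeas) hfin] with a ha
    have h2 : Summable fun i => ‖F i a‖₊ := ENNReal.tsum_coe_ne_top_iff_summable.mp ha.ne
    exact Summable.of_nnnorm h2
  refine ⟨aestronglyMeasurable_of_tendsto_ae Filter.atTop
    (f := fun N a => ∑ i ∈ Finset.range N, F i a) (fun N => ?_) ?_, ?_⟩
  · exact (integrable_finsetSum _ fun i _ => hF i).aestronglyMeasurable
  · filter_upwards [hsum] with a ha
    exact ha.hasSum.tendsto_sum_nat
  · refine lt_of_le_of_lt (lintegral_mono fun a => ?_) hfin.lt_top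
    exact enorm_tsum_le_tsum_enorm

end Young

/-! ### Integrability of the derivatives of order `k - 1` -/

section Regularity

open SchwartzMap LineDeriv

variable {n m d : ℕ} {V W : Type*}
  [NormedAddCommGroup V] [InnerProductSpace ℝ V] [FiniteDimensional ℝ V]
  [NormedAddCommGroup W] [InnerProductSpace ℝ W] [FiniteDimensional ℝ W]

theorem schwartzPartial_compSubConst (α : MultiIdx n m) (a : Eu n) (f : 𝓢(Eu n, ℝ)) :
    schwartzPartial α (compSubConstCLM ℝ a f) = compSubConstCLM ℝ a (schwartzPartial α f) := by
  induction m with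
  | zero => simp only [schwartzPartial_zero]
  | succ m ih =>
    obtain ⟨β, i, rfl⟩ := α.exists_eq_succ
    rw [schwartzPartial_succ, schwartzPartial_succ, ih]
    ext x
    rw [compSubConstCLM_apply, lineDerivOp_apply_eq_fderiv, lineDerivOp_apply_eq_fderiv]
    have h : (compSubConstCLM ℝ a (schwartzPartial β f) : Eu n → ℝ) =
        fun x => schwartzPartial β f (x - a) := funext fun x => compSubConstCLM_apply _ _ _
    rw [h, fderiv_comp_sub]

theorem integral_mul_schwartzPartial_sub (γ : MultiIdx n m) (φ ρ : 𝓢(Eu n, ℝ)) (y : Eu n) :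
    ∫ x, φ x * schwartzPartial γ ρ (x - y) =
      (-1 : ℝ) ^ m * ∫ z, schwartzPartial γ φ (z + y) * ρ z := by
  have h := integral_schwartzPartial_smul γ (compSubConstCLM ℝ (-y) φ) ρ
  rw [schwartzPartial_compSubConst] at h
  simp only [compSubConstCLM_apply, sub_neg_eq_add, smul_eq_mul] at h
  rw [← h, ← integral_add_right_eq_self _ y]
  simp

/-- Testing the derivatives of the mollifications converges to testing the distributional
derivative. -/
theorem tendsto_integral_smul_mollified {Ω : Opens (Eu n)} {u : Eu n → V}
    (hu : IntegrableOn u (Ω : Set (Eu n))) (γ : MultiIdx n m) {θ X : 𝓢(Eu n, ℝ)} (hθ0 : θ 0 = 1)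
    (hθ : ∀ x, |θ x| ≤ 1) (hX : ∫ x, X x = 1) (φ : 𝓢(Eu n, ℝ)) :
    Filter.Tendsto (fun N => ∫ x, φ x • ∫ y in (Ω : Set (Eu n)),
        schwartzPartial γ (schwartzMul θ (rescale N X)) (x - y) • u y) Filter.atTop
      (nhds ((-1 : ℝ) ^ m • ∫ y in (Ω : Set (Eu n)), schwartzPartial γ φ y • u y)) := by
  have hcV := FiniteDimensional.complete ℝ V
  set ρ : ℕ → 𝓢(Eu n, ℝ) := fun N => schwartzMul θ (rescale N X) with hρ
  -- Fubini and integration by parts move `∂^γ` from the mollifier to `φ`.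
  have hfub : ∀ N, ∫ x, φ x • ∫ y in (Ω : Set (Eu n)), schwartzPartial γ (ρ N) (x - y) • u y =
      ∫ y in (Ω : Set (Eu n)), ((-1 : ℝ) ^ m * ∫ z, schwartzPartial γ φ (z + y) * ρ N z) • u y := by
    intro N
    have h1 := integrable_prod_kernel (μ := volume.restrict (Ω : Set (Eu n)))
      (κ := fun z => schwartzPartial γ (ρ N) z • ContinuousLinearMap.id ℝ V) (by fun_prop)
      ((schwartzPartial γ (ρ N)).integrable.smul_const _) hu
    have h2 : Integrable (fun p : Eu n × Eu n =>
        φ p.1 • schwartzPartial γ (ρ N) (p.1 - p.2) • u p.2)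
        (volume.prod (volume.restrict (Ω : Set (Eu n)))) :=
      h1.bdd_smul (SchwartzMap.seminorm ℝ 0 0 φ)
        (φ.continuous.comp continuous_fst).aestronglyMeasurable
        (ae_of_all _ fun p => φ.norm_le_seminorm ℝ p.1)
    simp only [← integral_smul]
    rw [integral_integral_swap (f := fun x y => φ x • schwartzPartial γ (ρ N) (x - y) • u y) h2]
    congr 1
    funext y
    rw [← integral_mul_schwartzPartial_sub, ← integral_smul_const]
    simp only [mul_smul]
  refine Filter.Tendsto.congr (fun N => (hfub N).symm) ?_
  rw [← integral_smul]
  have hB : ∀ x, |schwartzPartial γ φ x| ≤ SchwartzMap.seminorm ℝ 0 0 (schwartzPartial γ φ) :=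
    fun x => (schwartzPartial γ φ).norm_le_seminorm ℝ x
  set B := SchwartzMap.seminorm ℝ 0 0 (schwartzPartial γ φ)
  have hB0 : 0 ≤ B := (abs_nonneg _).trans (hB 0)
  have hbd : ∀ N y, |∫ z, schwartzPartial γ φ (z + y) * ρ N z| ≤ B * ∫ x, |X x| := by
    intro N y
    rw [← integral_abs_rescale N X, ← integral_const_mul, ← Real.norm_eq_abs]
    refine norm_integral_le_of_norm_le ((SchwartzMap.integrable _).abs.const_mul B)
      (ae_of_all _ fun z => ?_)
    rw [norm_mul, hρ, schwartzMul_apply, norm_mul]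
    refine mul_le_mul (hB _) (mul_le_of_le_one_left (norm_nonneg _) (hθ z)) (by positivity) hB0
  -- The inner integrals converge pointwise by the approximate identity and are bounded uniformly in
  -- `N` and `y`, so a multiple of `‖u‖` dominates.
  refine tendsto_integral_of_dominated_convergence (fun y => (B * ∫ x, |X x|) * ‖u y‖)
    (fun N => ?_) (hu.norm.const_mul _) (fun N => ae_of_all _ fun y => ?_)
    (ae_of_all _ fun y => ?_)
  · refine AEStronglyMeasurable.smul ?_ hu.aestronglyMeasurable
    refine (Continuous.aestronglyMeasurable ?_).const_mul _
    refine continuous_of_dominated (bound := fun z => B * |ρ N z|) (fun y => ?_)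
      (fun y => ae_of_all _ fun z => ?_) ((SchwartzMap.integrable _).abs.const_mul B)
      (ae_of_all _ fun z => by fun_prop)
    · exact Continuous.aestronglyMeasurable (by fun_prop)
    · rw [norm_mul]
      exact mul_le_mul_of_nonneg_right (hB _) (abs_nonneg _)
  · rw [norm_smul, norm_mul, norm_pow, norm_neg, norm_one, one_pow, one_mul]
    exact mul_le_mul_of_nonneg_right (hbd N y) (norm_nonneg _)
  · have h3 := tendsto_integral_mul_rescale hθ0 hθ hX
      (h := fun z => schwartzPartial γ φ (z + y)) (by fun_prop) (fun z => hB _)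
    rw [zero_add] at h3
    rw [smul_smul]
    exact (h3.const_mul _).smul_const _

/-- For elliptic `A` of order `m + 1`, a function of bounded `A`-variation has integrable
derivatives of order `m` away from the boundary. -/
theorem exists_integrable_localDerivative {A : HomOp n (m + 1) V W} (hA : A.IsElliptic)
    {Ω : Opens (Eu n)} {u : Eu n → V} (hu : IntegrableOn u (Ω : Set (Eu n)))
    {μ : RadonMeasure Ω W} (hμb : μ.IsBounded) (hμ : A.Represents Ω u μ) (γ : MultiIdx n m)
    {ε : ℝ} (hε : 0 < ε) :
    ∃ g : Eu n → V, Integrable g ∧ ∀ φ : 𝓢(Eu n, ℝ),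
      (∀ x, φ x ≠ 0 → Metric.closedBall x ε ⊆ Ω) →
      ∫ x, φ x • g x =
        (-1 : ℝ) ^ m • ∫ y in (Ω : Set (Eu n)), schwartzPartial γ φ y • u y := by
  have hcV := FiniteDimensional.complete ℝ V
  obtain ⟨X, d, q, b, hX, hq⟩ := exists_dyadic_parametrix hA γ
  obtain ⟨θ, hθ1, hθ, hθs⟩ := exists_cutoff (n := n) hε
  have hθ0 : θ 0 = 1 := hθ1 0 (Metric.mem_ball_self (half_pos hε))
  obtain ⟨C₁, hC₁, h₁⟩ := exists_integral_norm_localKernel_le hθ q b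
  obtain ⟨C₂, hC₂, h₂⟩ := exists_integral_norm_localError_le hε hθ1 hθs hq
  -- Local finiteness supplies the s-finiteness of the base measure needed for the convolution
  -- estimates.
  have hlf := μ.locallyFinite
  let H : ℕ → Eu n → V := fun N x => ∫ y in (Ω : Set (Eu n)),
    schwartzPartial γ (schwartzMul θ (rescale N X)) (x - y) • u y
  let S₁ : ℕ → Eu n → V := fun N x =>
    ∫ y in (Ω : Set (Eu n)), localKernel θ q b N (x - y) (μ.density y) ∂μ.base
  let S₂ : ℕ → Eu n → V := fun N x =>
    ∫ y in (Ω : Set (Eu n)), localError A γ θ X q b N (x - y) (u y)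
  have hH : ∀ N, Integrable (H N) := fun N =>
    integrable_kernel (μ := volume.restrict (Ω : Set (Eu n)))
      (κ := fun z => schwartzPartial γ (schwartzMul θ (rescale N X)) z •
        ContinuousLinearMap.id ℝ V) (by fun_prop) ((SchwartzMap.integrable _).smul_const _) hu
  have hS₁ : ∀ N, Integrable (S₁ N) := fun N =>
    integrable_kernel (continuous_localKernel θ q b N) (integrable_localKernel θ q b N) hμb
  have hS₂ : ∀ N, Integrable (S₂ N) := fun N =>
    integrable_kernel (continuous_localError A γ θ X q b N) (integrable_localError hθs N) hu
  let C := C₁ * (∫ y in (Ω : Set (Eu n)), ‖μ.density y‖ ∂μ.base) +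
    C₂ * ∫ y in (Ω : Set (Eu n)), ‖u y‖
  let S : ℕ → Eu n → V := fun N x => S₁ N x + S₂ N x
  have hS : ∀ N, Integrable (S N) := fun N => (hS₁ N).add (hS₂ N)
  have hSnorm : ∀ N, ∫ x, ‖S N x‖ ≤ C * ((2 : ℝ) ^ N)⁻¹ := by
    intro N
    calc ∫ x, ‖S N x‖ ≤ ∫ x, (‖S₁ N x‖ + ‖S₂ N x‖) :=
          integral_mono (hS N).norm ((hS₁ N).norm.add (hS₂ N).norm) fun x => norm_add_le _ _
      _ = (∫ x, ‖S₁ N x‖) + ∫ x, ‖S₂ N x‖ := integral_add (hS₁ N).norm (hS₂ N).norm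
      _ ≤ C₁ * ((2 : ℝ) ^ N)⁻¹ * (∫ y in (Ω : Set (Eu n)), ‖μ.density y‖ ∂μ.base) +
          C₂ * ((2 : ℝ) ^ N)⁻¹ * ∫ y in (Ω : Set (Eu n)), ‖u y‖ := by
          refine add_le_add ?_ ?_
          · exact (integral_norm_kernel_le (continuous_localKernel θ q b N)
              (integrable_localKernel θ q b N) hμb).trans
              (mul_le_mul_of_nonneg_right (h₁ N) (integral_nonneg fun y => norm_nonneg _))
          · exact (integral_norm_kernel_le (continuous_localError A γ θ X q b N)
              (integrable_localError hθs N) hu).trans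
              (mul_le_mul_of_nonneg_right (h₂ N) (integral_nonneg fun y => norm_nonneg _))
      _ = _ := by ring
  have hgeom : Summable fun N : ℕ => ((2 : ℝ) ^ N)⁻¹ := by
    simp only [← inv_pow]
    exact summable_geometric_of_lt_one (by norm_num) (by norm_num)
  have hsum : Summable fun N => ∫ x, ‖S N x‖ :=
    Summable.of_nonneg_of_le (fun N => integral_nonneg fun x => norm_nonneg _) hSnorm
      (hgeom.mul_left C)
  have hT : Integrable fun x => ∑' N, S N x := integrable_tsum_of_summable_integral_norm hS hsum
  -- The mollification at scale `0` plus all dyadic increments. The increments are written as `S₁ +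
  -- S₂`, which is defined and integrable on all of `ℝⁿ`, although it equals `H (N + 1) - H N` only
  -- where the `ε`-ball stays in `Ω`.
  refine ⟨fun x => H 0 x + ∑' N, S N x, (hH 0).add hT, fun φ hφ => ?_⟩
  have hbdd : ∀ {f : Eu n → V}, Integrable f → Integrable fun x => φ x • f x := fun hf =>
    hf.bdd_smul (SchwartzMap.seminorm ℝ 0 0 φ) φ.continuous.aestronglyMeasurable
      (ae_of_all _ fun x => φ.norm_le_seminorm ℝ x)
  have hstep : ∀ N, ∫ x, φ x • S N x = (∫ x, φ x • H (N + 1) x) - ∫ x, φ x • H N x := by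
    intro N
    rw [← integral_sub (hbdd (hH _)) (hbdd (hH _))]
    congr 1
    funext x
    rw [← smul_sub]
    by_cases hx : φ x = 0
    · rw [hx, zero_smul, zero_smul]
    · exact congrArg (φ x • ·) (localKernel_add_localError hθs hu hμ N (hφ x hx))
  have hhs : HasSum (fun N => ∫ x, φ x • S N x) (∫ x, ∑' N, φ x • S N x) := by
    refine hasSum_integral_of_summable_integral_norm (fun N => hbdd (hS N)) ?_
    refine Summable.of_nonneg_of_le (fun N => integral_nonneg fun x => norm_nonneg _)
      (fun N => ?_) (hsum.mul_left (SchwartzMap.seminorm ℝ 0 0 φ))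
    rw [← integral_const_mul]
    refine integral_mono (hbdd (hS N)).norm ((hS N).norm.const_mul _) fun x => ?_
    simp only [norm_smul]
    exact mul_le_mul_of_nonneg_right (φ.norm_le_seminorm ℝ x) (norm_nonneg _)
  have hlim := (hhs.tendsto_sum_nat.const_add (∫ x, φ x • H 0 x))
  have htel : ∀ N, (∫ x, φ x • H 0 x) + ∑ i ∈ Finset.range N, ∫ x, φ x • S i x =
      ∫ x, φ x • H N x := fun N => by
    rw [Finset.sum_congr rfl fun i _ => hstep i,
      Finset.sum_range_sub (fun N => ∫ x, φ x • H N x), add_sub_cancel]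
  simp only [htel] at hlim
  have h3 : ∫ x, φ x • (H 0 x + ∑' N, S N x) =
      (∫ x, φ x • H 0 x) + ∫ x, ∑' N, φ x • S N x := by
    simp only [smul_add]
    rw [integral_add (hbdd (hH 0)) (hbdd hT)]
    simp only [tsum_const_smul'']
  rw [h3]
  exact tendsto_nhds_unique hlim (tendsto_integral_smul_mollified hu γ hθ0 hθ hX φ)

end Regularity

/-! ### Integrability of maps into symmetric tensors -/

section SymTensorIntegrable

variable {α : Type*} [MeasurableSpace α] {ν : Measure α} {n m : ℕ} {V : Type*}
  [NormedAddCommGroup V] [NormedSpace ℝ V] [FiniteDimensional ℝ V]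

theorem integrable_linearMap_comp {X Y : Type*}
    [NormedAddCommGroup X] [NormedSpace ℝ X] [FiniteDimensional ℝ X]
    [NormedAddCommGroup Y] [NormedSpace ℝ Y] (L : X →ₗ[ℝ] Y) {f : α → X} (hf : Integrable f ν) :
    Integrable (fun x => L (f x)) ν :=
  (LinearMap.toContinuousLinearMap L).integrable_comp hf

theorem integrable_symTensor_comp (L : SymTensor n m V →ₗ[ℝ] V) {G : α → SymTensor n m V}
    (hG : Integrable G ν) : Integrable (fun x => L (G x)) ν :=
  integrable_linearMap_comp L hG

theorem integrable_comp_symTensor (L : (MultiIdx n m → V) →ₗ[ℝ] SymTensor n m V)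
    {g : MultiIdx n m → α → V} (hg : ∀ γ, Integrable (g γ) ν) :
    Integrable (fun x => L fun γ => g γ x) ν :=
  integrable_linearMap_comp (X := MultiIdx n m → V) (Y := SymTensor n m V) L
    (Integrable.of_eval hg)

theorem integrable_coeffEquiv_symm {g : MultiIdx n m → α → V} (hg : ∀ γ, Integrable (g γ) ν) :
    Integrable (fun x => (coeffEquiv n m V).symm fun γ => g γ x) ν :=
  integrable_comp_symTensor (coeffEquiv n m V).symm.toLinearMap hg

end SymTensorIntegrable

/-! ### Weak derivatives of order `k - 1` -/

section WeakGradient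

open SchwartzMap
open scoped ContDiff

variable {n m : ℕ} {V W : Type*}
  [NormedAddCommGroup V] [InnerProductSpace ℝ V] [FiniteDimensional ℝ V]
  [NormedAddCommGroup W] [InnerProductSpace ℝ W] [FiniteDimensional ℝ W]

theorem ae_eq_of_integral_schwartz_smul_eq {U : Opens (Eu n)} {f g : Eu n → V}
    (hf : LocallyIntegrableOn f (U : Set (Eu n))) (hg : LocallyIntegrableOn g (U : Set (Eu n)))
    (h : ∀ φ : 𝓢(Eu n, ℝ), HasCompactSupport φ → tsupport φ ⊆ U →
      ∫ x, φ x • f x = ∫ x, φ x • g x) :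
    ∀ᵐ x, x ∈ (U : Set (Eu n)) → f x = g x := by
  have hcV := FiniteDimensional.complete ℝ V
  have h0 := U.isOpen.ae_eq_zero_of_integral_contDiff_smul_eq_zero (hf.sub hg)
    fun φ hφ hc hs => by
    have hint : ∀ {F : Eu n → V}, LocallyIntegrableOn F (U : Set (Eu n)) →
        Integrable fun x => φ x • F x := fun {F} hF => by
      have h1 : IntegrableOn (fun x => φ x • F x) (tsupport φ) :=
        (hF.integrableOn_compact_subset hs hc).continuousOn_smul
          hφ.continuous.continuousOn hc
      refine (integrableOn_iff_integrable_of_support_subset ?_).mp h1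
      exact (Function.support_smul_subset_left _ _).trans (subset_tsupport _)
    simp only [Pi.sub_apply, smul_sub]
    rw [integral_sub (hint hf) (hint hg), sub_eq_zero]
    exact h (hc.toSchwartzMap hφ) hc hs
  filter_upwards [h0] with x hx hxU
  exact sub_eq_zero.mp (hx hxU)

/-- At each point use the function with the first index whose set contains it. Countably many null
sets are discarded. -/
theorem exists_ae_eq_of_monotone {α E : Type*} [MeasurableSpace α] [Zero E] {μ : Measure α}
    {U : ℕ → Set α} {f : ℕ → α → E}
    (h : ∀ i j, i ≤ j → ∀ᵐ x ∂μ, x ∈ U i → f j x = f i x) :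
    ∃ g : α → E, ∀ j, ∀ᵐ x ∂μ, x ∈ U j → g x = f j x := by
  classical
  refine ⟨fun x => if hx : ∃ j, x ∈ U j then f (Nat.find hx) x else 0, fun j => ?_⟩
  have h' : ∀ᵐ x ∂μ, ∀ i j, i ≤ j → x ∈ U i → f j x = f i x :=
    ae_all_iff.mpr fun i => ae_all_iff.mpr fun j => by
      by_cases hij : i ≤ j
      · filter_upwards [h i j hij] with x hx _ using hx
      · exact ae_of_all _ fun x hx => absurd hx hij
  filter_upwards [h'] with x hx hxj
  have he : ∃ j, x ∈ U j := ⟨j, hxj⟩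
  rw [dif_pos he]
  exact (hx _ _ (Nat.find_min' he hxj) (Nat.find_spec he)).symm

/-- For elliptic `A` of order `m + 1`, a function of bounded `A`-variation has locally integrable
weak derivatives of order `m`. -/
theorem exists_locallyIntegrableOn_derivative {A : HomOp n (m + 1) V W} (hA : A.IsElliptic)
    {Ω : Opens (Eu n)} {u : Eu n → V} (hu : IntegrableOn u (Ω : Set (Eu n)))
    {μ : RadonMeasure Ω W} (hμb : μ.IsBounded) (hμ : A.Represents Ω u μ) (γ : MultiIdx n m) :
    ∃ g : Eu n → V, LocallyIntegrableOn g (Ω : Set (Eu n)) ∧ ∀ φ : 𝓓(Ω, ℝ),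
      ∫ x in (Ω : Set (Eu n)), φ x • g x =
        (-1 : ℝ) ^ m • ∫ y in (Ω : Set (Eu n)), partialD γ φ y • u y := by
  let ε : ℕ → ℝ := fun j => 1 / ((j : ℝ) + 1)
  have hε : ∀ j, 0 < ε j := fun j => Nat.one_div_pos_of_nat
  -- The points at distance more than `ε j` from the complement of `Ω`: they form an increasing open
  -- exhaustion, and the closed `ε j`-ball about each lies in `Ω`.
  let U : ℕ → Opens (Eu n) := fun j =>
    ⟨(Metric.cthickening (ε j) (Ω : Set (Eu n))ᶜ)ᶜ, Metric.isClosed_cthickening.isOpen_compl⟩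
  have hU : ∀ j x, x ∈ U j → Metric.closedBall x (ε j) ⊆ Ω := fun j x hx y hy => by
    by_contra hyΩ
    exact hx (Metric.mem_cthickening_of_dist_le x y _ _ hyΩ (by rwa [dist_comm]))
  have hUΩ : ∀ j, (U j : Set (Eu n)) ⊆ Ω := fun j x hx =>
    hU j x hx (Metric.mem_closedBall_self (hε j).le)
  have hUmono : Monotone fun j => (U j : Set (Eu n)) := fun i j hij =>
    Set.compl_subset_compl.mpr (Metric.cthickening_mono (Nat.one_div_le_one_div hij) _)
  have hcover : (Ω : Set (Eu n)) ⊆ ⋃ j, (U j : Set (Eu n)) := fun x hx => by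
    obtain ⟨r, hr, hball⟩ := Metric.isOpen_iff.mp Ω.isOpen x hx
    obtain ⟨j, hj⟩ := exists_nat_one_div_lt hr
    refine Set.mem_iUnion.mpr ⟨j, fun hx' => ?_⟩
    obtain ⟨y, hy, hxy⟩ := Metric.mem_thickening_iff.mp
      (Metric.cthickening_subset_thickening' hr hj _ hx')
    exact hy (hball (by rwa [Metric.mem_ball, dist_comm]))
  choose f hf hfφ using fun j => exists_integrable_localDerivative hA hu hμb hμ γ (hε j)
  have hfU : ∀ j (φ : 𝓢(Eu n, ℝ)), tsupport φ ⊆ U j → ∫ x, φ x • f j x =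
      (-1 : ℝ) ^ m • ∫ y in (Ω : Set (Eu n)), schwartzPartial γ φ y • u y := fun j φ hφ =>
    hfφ j φ fun x hx => hU j x (hφ (subset_tsupport _ hx))
  obtain ⟨g, hg⟩ := exists_ae_eq_of_monotone (U := fun j => (U j : Set (Eu n))) (f := f)
    (μ := volume) fun i j hij =>
      ae_eq_of_integral_schwartz_smul_eq ((hf j).locallyIntegrable.locallyIntegrableOn _)
        ((hf i).locallyIntegrable.locallyIntegrableOn _) fun φ _ hφ => by
        rw [hfU i φ hφ, hfU j φ (hφ.trans (hUmono hij))]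
  refine ⟨g, fun x hx => ?_, fun φ => ?_⟩
  · obtain ⟨j, hj⟩ := Set.mem_iUnion.mp (hcover hx)
    refine ⟨U j, mem_nhdsWithin_of_mem_nhds ((U j).isOpen.mem_nhds hj), ?_⟩
    refine (hf j).integrableOn.congr_fun_ae ?_
    rw [Filter.EventuallyEq, ae_restrict_iff' (U j).isOpen.measurableSet]
    filter_upwards [hg j] with x hx hxj using (hx hxj).symm
  -- By compactness and monotonicity a single `U j` contains the support of `φ`.
  · obtain ⟨j, hj⟩ := φ.hasCompactSupport.isCompact.elim_directed_cover
      (fun j => (U j : Set (Eu n))) (fun j => (U j).isOpen)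
      (φ.tsupport_subset.trans hcover) hUmono.directed_le
    have h1 : ∫ x in (Ω : Set (Eu n)), φ x • g x = ∫ x in (Ω : Set (Eu n)), φ x • f j x := by
      refine integral_congr_ae (ae_restrict_of_ae ?_)
      filter_upwards [hg j] with x hx
      by_cases hxj : x ∈ (U j : Set (Eu n))
      · rw [hx hxj]
      · rw [image_eq_zero_of_notMem_tsupport fun h => hxj (hj h), zero_smul, zero_smul]
    rw [h1, setIntegral_eq_integral_of_forall_compl_eq_zero fun x hx => by
      rw [image_eq_zero_of_notMem_tsupport fun h => hx (φ.tsupport_subset h), zero_smul]]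
    have h2 := hfU j (toSchwartz φ) hj
    simp only [schwartzPartial_apply, coe_toSchwartz] at h2
    exact h2

theorem exists_isWeakGrad {A : HomOp n (m + 1) V W} (hA : A.IsElliptic) {Ω : Opens (Eu n)}
    {u : Eu n → V} (hu : A.MemBV Ω u) : ∃ G : Eu n → SymTensor n m V, IsWeakGrad Ω u G := by
  obtain ⟨hint, μ, hμb, hμ⟩ := hu
  choose g hg hgφ using exists_locallyIntegrableOn_derivative hA hint hμb hμ
  refine ⟨fun x => (coeffEquiv n m V).symm fun γ => g γ x, ?_, fun γ φ => ?_⟩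
  · rw [locallyIntegrableOn_iff Ω.isOpen.isLocallyClosed]
    intro K hK hKc
    exact integrable_coeffEquiv_symm fun γ => (hg γ).integrableOn_compact_subset hK hKc
  · rw [← hgφ γ φ]
    simp [← coeffEquiv_apply]

/-- On the whole space, weak derivatives of order `m` of functions of bounded `A`-variation are
integrable. -/
theorem IsWeakGrad.integrable_of_memBV_top {A : HomOp n (m + 1) V W} (hA : A.IsElliptic)
    {u : Eu n → V} (hu : A.MemBV ⊤ u) {G : Eu n → SymTensor n m V}
    (hG : IsWeakGrad ⊤ u G) : Integrable G := by
  obtain ⟨hint, μ, hμb, hμ⟩ := hu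
  have hcoeff : ∀ γ, Integrable fun x => SymTensor.coeff γ (G x) := by
    intro γ
    -- On the whole space the condition on balls is void, so radius `1` gives a globally integrable
    -- derivative, which coincides a.e. with the given coordinate.
    obtain ⟨g, hg, hgφ⟩ := exists_integrable_localDerivative hA hint hμb hμ γ one_pos
    have hloc : LocallyIntegrableOn (fun x => SymTensor.coeff γ (G x))
        ((⊤ : Opens (Eu n)) : Set (Eu n)) := fun x hx => by
      obtain ⟨t, ht, hi⟩ := hG.1 x hx
      exact ⟨t, ht, integrable_symTensor_comp (SymTensor.coeff γ) hi⟩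
    have hae := ae_eq_of_integral_schwartz_smul_eq (U := ⊤)
      (hg.locallyIntegrable.locallyIntegrableOn _) hloc fun φ hφ hs => by
      have h1 := hG.2 γ (ofSchwartz φ hφ hs)
      rw [hgφ φ fun x _ => by simp]
      simp only [coe_ofSchwartz, ← schwartzPartial_apply] at h1
      rw [← h1]
      simp
    refine hg.congr ?_
    filter_upwards [hae] with x hx using hx trivial
  have hsum : G = fun x => (coeffEquiv n m V).symm fun γ => SymTensor.coeff γ (G x) :=
    funext fun x => ((coeffEquiv n m V).symm_apply_apply (G x)).symm
  rw [hsum]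
  exact integrable_coeffEquiv_symm hcoeff

theorem RadonMeasure.IsBounded.pairZero {X Z : Type*} [NormedAddCommGroup X]
    [NormedAddCommGroup Z] {Ω : Opens (Eu n)} {μ : RadonMeasure Ω X} (h : μ.IsBounded) :
    (μ.pairZero Z).IsBounded :=
  Integrable.prodMk h (integrable_zero _ _ _)

end WeakGradient

end LinearizedOp

end

theorem theorem5p1 {V W : Type*}
    [NormedAddCommGroup V] [InnerProductSpace ℝ V] [FiniteDimensional ℝ V]
    [NormedAddCommGroup W] [InnerProductSpace ℝ W] [FiniteDimensional ℝ W]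
    (n m : ℕ) (A : LinearizedOp.HomOp n (m + 1) V W) :
    -- ellipticity
    ((LinearizedOp.linearize A).IsElliptic ↔ A.IsElliptic) ∧
    -- complex ellipticity
    ((LinearizedOp.linearize A).IsCElliptic ↔ A.IsCElliptic) ∧
    -- functions of bounded variation
    (A.IsElliptic → ∀ (Ω : Opens (LinearizedOp.Eu n)) (u : LinearizedOp.Eu n → V),
      A.MemBV Ω u →
        (∃ G : LinearizedOp.Eu n → LinearizedOp.SymTensor n m V,
          LinearizedOp.IsWeakGrad Ω u G) ∧
        ∀ G : LinearizedOp.Eu n → LinearizedOp.SymTensor n m V,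
          LinearizedOp.IsWeakGrad Ω u G →
            (LinearizedOp.linearize A).MemBVLoc Ω G ∧
            (∀ μ : LinearizedOp.RadonMeasure Ω W, A.Represents Ω u μ →
              (LinearizedOp.linearize A).Represents Ω G
                (μ.pairZero (LinearizedOp.CurlTarget n m V))) ∧
            (Ω = ⊤ ∨ IntegrableOn G (Ω : Set (LinearizedOp.Eu n)) →
              (LinearizedOp.linearize A).MemBV Ω G)) ∧
    -- jumps
    (∀ (fp fm : LinearizedOp.SymTensor n m V) (ν : LinearizedOp.Eu n), ‖ν‖ = 1 →
      ((∃ μ : LinearizedOp.RadonMeasure (⊤ : Opens (LinearizedOp.Eu n)) W,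
          (LinearizedOp.linearize A).Represents ⊤ (LinearizedOp.jumpMap fp fm ν)
            (μ.pairZero (LinearizedOp.CurlTarget n m V))) ↔
        ∃ a : V, fp - fm = LinearizedOp.SymTensor.pure m a ν)) := by

  refine ⟨LinearizedOp.linearize_isElliptic_iff A, LinearizedOp.linearize_isCElliptic_iff A,
    fun hA Ω u hu => ⟨LinearizedOp.exists_isWeakGrad hA hu, fun G hG => ?_⟩,
    LinearizedOp.exists_represents_jumpMap_iff A⟩
  have hrep : ∀ μ : LinearizedOp.RadonMeasure Ω W, A.Represents Ω u μ → _ := fun _ hμ =>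
    hG.represents_linearize hu.1.locallyIntegrableOn hμ
  obtain ⟨hint, μ, hμb, hμ⟩ := id hu
  -- The bounded measure representing `A u`, paired with zero, serves both the local and the global
  -- statement; only the integrability of `G` remains.
  refine ⟨⟨hG.1, _, hrep μ hμ⟩, hrep, fun h => ⟨?_, _, hμb.pairZero, hrep μ hμ⟩⟩
  rcases h with rfl | h
  · exact (hG.integrable_of_memBV_top hA hu).integrableOn
  · exact h
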